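/- Let $\Omega\subseteq\mathbb R^3$ be open, with coordinates $(x,f,g)$, and let $A^i,B^i,C^i,D^i:\Omega\to\mathbb R$ $(i=1,2)$ be such that $A^1+iA^2$, $B^1+iB^2$, $C^1+iC^2$, $D^1+iD^2$ are analytic functions $A,B,C,D$ of $(x,u)$ with $u=f+ig$; that is, near every point of $\Omega$ each of them is the restriction to real $x$ of a holomorphic function of two complex variables $(x,u)$. Consider the system of two second-order ODEs for real functions $f(x),g(x)$ $$\begin{aligned} f''={}&A^1f'^3-3A^1f'g'^2-3A^2f'^2g'+A^2g'^3+B^1f'^2-B^1g'^2-2B^2f'g'+C^1f'-C^2g'+D^1,\\ g''={}&3A^1f'^2g'-A^1g'^3+A^2f'^3-3A^2f'g'^2+2B^1f'g'+B^2f'^2-B^2g'^2+C^2f'+C^1g'+D^2, \end{aligned}$$ i.e. the real and imaginary parts of $u''=A(x,u)u'^3+B(x,u)u'^2+C(x,u)u'+D(x,u)$ with $u=f+ig$. The system is called solvable by complex linearization on $\Omega$ if near every point of $\Omega$ there are a point transformation $(x,u)\mapsto(\chi(x,u),U(x,u))$, holomorphic in the two complex variables and with nonzero Jacobian $\chi_xU_u-\chi_uU_x$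 there, and holomorphic functions $P,Q,R$ of one variable defined near the value of $\chi$ at that point, such that a pair $(f,g)$ of twice differentiable functions on an open interval, with graph close to the point and with $\frac{d}{dx}\chi(x,u(x))\neq0$, solves the system if and only if, along $x\mapsto(x,u(x))$, $u=f+ig$, the transformed variables satisfy the linear equation $$\frac{d^2U}{d\chi^2}=P(\chi)\frac{dU}{d\chi}+Q(\chi)U+R(\chi),\qquad \frac{d}{d\chi}=\Big(\frac{d\chi}{dx}\Big)^{-1}\frac{d}{dx}.$$ **Theorem 3.** The system is solvable by complex linearization on $\Omega$ if and only if the following four conditions hold at every point of $\Omega$ (subscripts $x,f,g$ denote partial derivatives): $$\begin{aligned} &12A^1_{xx}+12C^1A^1_x-12A^2_xC^2-6A^1_fD^1-6D^1A^2_g+6D^2A^2_f-6D^2A^1_g+12A^1C^1_x-12A^2C^2_x\\ &\quad+C^1_{ff}-C^1_{gg}+2C^2_{fg}-12A^1D^1_f-12A^1D^2_g+12A^2D^2_f-12A^2D^1_g+2B^1C^1_f+2B^1C^2_g\\ &\quad-2B^2C^2_f+2B^2C^1_g-8B^1B^1_x+8B^2B^2_x-4B^1_{xf}-4B^2_{xg}=0,\\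 &12A^2_{xx}+12C^2A^1_x+12A^2_xC^1-6D^2A^1_f-6D^2A^2_g-6D^1A^2_f+6D^1A^1_g+12A^2C^1_x+12A^1C^2_x\\ &\quad+C^2_{ff}-C^2_{gg}-2C^1_{fg}-12A^2D^1_f-12A^2D^2_g-12A^1D^2_f+12A^1D^1_g+2B^2C^1_f+2B^2C^2_g\\ &\quad+2B^1C^2_f-2B^1C^1_g-8B^2B^1_x-8B^1B^2_x-4B^2_{xf}+4B^1_{xg}=0,\\ &24D^1A^1_x-24D^2A^2_x-6D^1B^1_f-6D^1B^2_g+6D^2B^2_f-6D^2B^1_g+12A^1D^1_x-12A^2D^2_x+4B^1_{xx}\\ &\quad-4C^1_{xf}-4C^2_{xg}-6B^1D^1_f-6B^1D^2_g+6B^2D^2_f-6B^2D^1_g+3D^1_{ff}-3D^1_{gg}+6D^2_{fg}\\ &\quad+4C^1C^1_f+4C^1C^2_g-4C^2C^2_f+4C^2C^1_g-4C^1B^1_x+4C^2B^2_x=0,\\ &24D^2A^1_x+24D^1A^2_x-6D^2B^1_f-6D^2B^2_g-6D^1B^2_f+6D^1B^1_g+12A^2D^1_x+12A^1D^2_x+4B^2_{xx}\\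 &\quad-4C^2_{xf}+4C^1_{xg}-6B^2D^1_f-6B^2D^2_g-6B^1D^2_f+6B^1D^1_g+3D^2_{ff}-3D^2_{gg}-6D^1_{fg}\\ &\quad+4C^2C^1_f+4C^2C^2_g+4C^1C^2_f-4C^1C^1_g-4C^2B^1_x-4C^1B^2_x=0. \end{aligned}$$ -/

import Mathlib

open Filter Topology Set

noncomputable section

namespace CplxLin

/-- The complexification map `(x, f, g) ↦ (x, u)`, `u = f + i g`, from real three-space into `ℂ²`. -/
def toComplex (p : ℝ × ℝ × ℝ) : ℂ × ℂ :=
  ((p.1 : ℂ), (p.2.1 : ℂ) + (p.2.2 : ℂ) * Complex.I)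

/-- `F¹, F²` are on `Ω` the real and imaginary parts of an analytic function `F(x, u)`,
`u = f + i g`: near every point of `Ω` there is a function `F`, analytic in the two complex
variables, with `F(x, f + i g) = F¹(x, f, g) + i F²(x, f, g)` (for real `x`). -/
def IsAnalyticSplitting (Ω : Set (ℝ × ℝ × ℝ)) (F₁ F₂ : ℝ → ℝ → ℝ → ℝ) : Prop :=
  ∀ p ∈ Ω, ∃ F : ℂ × ℂ → ℂ, AnalyticAt ℂ F (toComplex p) ∧
    ∀ᶠ q in 𝓝 p, F (toComplex q) =
      (F₁ q.1 q.2.1 q.2.2 : ℂ) + (F₂ q.1 q.2.1 q.2.2 : ℂ) * Complex.I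

/-- The eight real coefficient functions of `(x, f, g)`. -/
structure Coeffs where
  A₁ : ℝ → ℝ → ℝ → ℝ
  A₂ : ℝ → ℝ → ℝ → ℝ
  B₁ : ℝ → ℝ → ℝ → ℝ
  B₂ : ℝ → ℝ → ℝ → ℝ
  C₁ : ℝ → ℝ → ℝ → ℝ
  C₂ : ℝ → ℝ → ℝ → ℝ
  D₁ : ℝ → ℝ → ℝ → ℝ
  D₂ : ℝ → ℝ → ℝ → ℝ

/-- Right-hand side of the equation for `f''`; `p, q` stand for `f', g'`. -/
def Coeffs.rhs₁ (S : Coeffs) (x f g p q : ℝ) : ℝ :=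
  S.A₁ x f g * p ^ 3 - 3 * S.A₁ x f g * p * q ^ 2 - 3 * S.A₂ x f g * p ^ 2 * q
    + S.A₂ x f g * q ^ 3 + S.B₁ x f g * p ^ 2 - S.B₁ x f g * q ^ 2 - 2 * S.B₂ x f g * p * q
    + S.C₁ x f g * p - S.C₂ x f g * q + S.D₁ x f g

/-- Right-hand side of the equation for `g''`; `p, q` stand for `f', g'`. -/
def Coeffs.rhs₂ (S : Coeffs) (x f g p q : ℝ) : ℝ :=
  3 * S.A₁ x f g * p ^ 2 * q - S.A₁ x f g * q ^ 3 + S.A₂ x f g * p ^ 3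
    - 3 * S.A₂ x f g * p * q ^ 2 + 2 * S.B₁ x f g * p * q + S.B₂ x f g * p ^ 2
    - S.B₂ x f g * q ^ 2 + S.C₂ x f g * p + S.C₁ x f g * q + S.D₂ x f g

/-- `h` is twice differentiable at every point of the open set `J`. -/
def TwiceDiffOn (h : ℝ → ℝ) (J : Set ℝ) : Prop :=
  ∀ x ∈ J, DifferentiableAt ℝ h x ∧ DifferentiableAt ℝ (deriv h) x

/-- `(f, g)` solves `f'' = w₁(x, f, g, f', g')`, `g'' = w₂(x, f, g, f', g')` on the open set `J`. -/
def IsSolutionOn (w₁ w₂ : ℝ → ℝ → ℝ → ℝ → ℝ → ℝ) (f g : ℝ → ℝ) (J : Set ℝ) : Prop :=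
  TwiceDiffOn f J ∧ TwiceDiffOn g J ∧ ∀ x ∈ J,
    deriv (deriv f) x = w₁ x (f x) (g x) (deriv f x) (deriv g x) ∧
    deriv (deriv g) x = w₂ x (f x) (g x) (deriv f x) (deriv g x)

/-- The function `x ↦ Ψ(x, u(x))` of the real variable `x`, where `u = f + i g`. -/
def along (Ψ : ℂ × ℂ → ℂ) (f g : ℝ → ℝ) (x : ℝ) : ℂ :=
  Ψ (toComplex (x, f x, g x))

/-- Derivative `dY/dX = Y' / X'` of `Y` with respect to `X` along a curve with parameter `x`. -/
def derivWrt (X Y : ℝ → ℂ) (x : ℝ) : ℂ := deriv Y x / deriv X x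

/-- The point transformation `(x, u) ↦ (χ, U)`, analytic with nonvanishing Jacobian at the
point corresponding to `p`, carries the system `f'' = w₁, g'' = w₂`, read through `u = f + i g`
as one complex equation, near `p` into the linear equation
`d²U/dχ² = P(χ) dU/dχ + Q(χ) U + R(χ)`: a pair `(f, g)` with graph near `p` along which `χ` can
be used as independent variable solves the system iff its image solves the linear equation. -/
structure LinearizesAt (w₁ w₂ : ℝ → ℝ → ℝ → ℝ → ℝ → ℝ) (p : ℝ × ℝ × ℝ)
    (χ U : ℂ × ℂ → ℂ) (P Q R : ℂ → ℂ) : Prop where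
  analytic_χ : AnalyticAt ℂ χ (toComplex p)
  analytic_U : AnalyticAt ℂ U (toComplex p)
  jacobian_ne_zero :
    fderiv ℂ χ (toComplex p) (1, 0) * fderiv ℂ U (toComplex p) (0, 1)
      - fderiv ℂ χ (toComplex p) (0, 1) * fderiv ℂ U (toComplex p) (1, 0) ≠ 0
  analytic_P : AnalyticAt ℂ P (χ (toComplex p))
  analytic_Q : AnalyticAt ℂ Q (χ (toComplex p))
  analytic_R : AnalyticAt ℂ R (χ (toComplex p))
  maps_solutions : ∃ W ∈ 𝓝 p, ∀ (a b : ℝ) (f g : ℝ → ℝ),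
    TwiceDiffOn f (Ioo a b) → TwiceDiffOn g (Ioo a b) →
    (∀ x ∈ Ioo a b, (x, f x, g x) ∈ W) →
    (∀ x ∈ Ioo a b, deriv (along χ f g) x ≠ 0) →
    (IsSolutionOn w₁ w₂ f g (Ioo a b) ↔
      ∀ x ∈ Ioo a b,
        derivWrt (along χ f g) (derivWrt (along χ f g) (along U f g)) x =
          P (along χ f g x) * derivWrt (along χ f g) (along U f g) x
            + Q (along χ f g x) * along U f g x + R (along χ f g x))

/-- The system `f'' = w₁, g'' = w₂` is solvable by complex linearization on `Ω`: near every
point of `Ω` the complex scalar equation for `u = f + i g` is carried into a linear equation by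
an analytic point transformation. -/
def SolvableByComplexLinearization (w₁ w₂ : ℝ → ℝ → ℝ → ℝ → ℝ → ℝ)
    (Ω : Set (ℝ × ℝ × ℝ)) : Prop :=
  ∀ p ∈ Ω, ∃ (χ U : ℂ × ℂ → ℂ) (P Q R : ℂ → ℂ), LinearizesAt w₁ w₂ p χ U P Q R

/-- Partial derivative `F_x`. -/
def dx (F : ℝ → ℝ → ℝ → ℝ) : ℝ → ℝ → ℝ → ℝ := fun x f g => deriv (fun t => F t f g) x

/-- Partial derivative `F_f`. -/
def df (F : ℝ → ℝ → ℝ → ℝ) : ℝ → ℝ → ℝ → ℝ := fun x f g => deriv (fun t => F x t g) f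

/-- Partial derivative `F_g`. -/
def dg (F : ℝ → ℝ → ℝ → ℝ) : ℝ → ℝ → ℝ → ℝ := fun x f g => deriv (fun t => F x f t) g

namespace Coeffs

/-- Left-hand side of the first condition. -/
def cond₁ (S : Coeffs) : ℝ → ℝ → ℝ → ℝ :=
  12 * dx (dx S.A₁) + 12 * S.C₁ * dx S.A₁ - 12 * dx S.A₂ * S.C₂
    - 6 * df S.A₁ * S.D₁ - 6 * S.D₁ * dg S.A₂ + 6 * S.D₂ * df S.A₂ - 6 * S.D₂ * dg S.A₁
    + 12 * S.A₁ * dx S.C₁ - 12 * S.A₂ * dx S.C₂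
    + df (df S.C₁) - dg (dg S.C₁) + 2 * dg (df S.C₂)
    - 12 * S.A₁ * df S.D₁ - 12 * S.A₁ * dg S.D₂ + 12 * S.A₂ * df S.D₂ - 12 * S.A₂ * dg S.D₁
    + 2 * S.B₁ * df S.C₁ + 2 * S.B₁ * dg S.C₂ - 2 * S.B₂ * df S.C₂ + 2 * S.B₂ * dg S.C₁
    - 8 * S.B₁ * dx S.B₁ + 8 * S.B₂ * dx S.B₂
    - 4 * df (dx S.B₁) - 4 * dg (dx S.B₂)

/-- Left-hand side of the second condition. -/
def cond₂ (S : Coeffs) : ℝ → ℝ → ℝ → ℝ :=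
  12 * dx (dx S.A₂) + 12 * S.C₂ * dx S.A₁ + 12 * dx S.A₂ * S.C₁
    - 6 * S.D₂ * df S.A₁ - 6 * S.D₂ * dg S.A₂ - 6 * S.D₁ * df S.A₂ + 6 * S.D₁ * dg S.A₁
    + 12 * S.A₂ * dx S.C₁ + 12 * S.A₁ * dx S.C₂
    + df (df S.C₂) - dg (dg S.C₂) - 2 * dg (df S.C₁)
    - 12 * S.A₂ * df S.D₁ - 12 * S.A₂ * dg S.D₂ - 12 * S.A₁ * df S.D₂ + 12 * S.A₁ * dg S.D₁
    + 2 * S.B₂ * df S.C₁ + 2 * S.B₂ * dg S.C₂ + 2 * S.B₁ * df S.C₂ - 2 * S.B₁ * dg S.C₁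
    - 8 * S.B₂ * dx S.B₁ - 8 * S.B₁ * dx S.B₂
    - 4 * df (dx S.B₂) + 4 * dg (dx S.B₁)

/-- Left-hand side of the third condition. -/
def cond₃ (S : Coeffs) : ℝ → ℝ → ℝ → ℝ :=
  24 * S.D₁ * dx S.A₁ - 24 * S.D₂ * dx S.A₂
    - 6 * S.D₁ * df S.B₁ - 6 * S.D₁ * dg S.B₂ + 6 * S.D₂ * df S.B₂ - 6 * S.D₂ * dg S.B₁
    + 12 * S.A₁ * dx S.D₁ - 12 * S.A₂ * dx S.D₂
    + 4 * dx (dx S.B₁) - 4 * df (dx S.C₁) - 4 * dg (dx S.C₂)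
    - 6 * S.B₁ * df S.D₁ - 6 * S.B₁ * dg S.D₂ + 6 * S.B₂ * df S.D₂ - 6 * S.B₂ * dg S.D₁
    + 3 * df (df S.D₁) - 3 * dg (dg S.D₁) + 6 * dg (df S.D₂)
    + 4 * S.C₁ * df S.C₁ + 4 * S.C₁ * dg S.C₂ - 4 * S.C₂ * df S.C₂ + 4 * S.C₂ * dg S.C₁
    - 4 * S.C₁ * dx S.B₁ + 4 * S.C₂ * dx S.B₂

/-- Left-hand side of the fourth condition. -/
def cond₄ (S : Coeffs) : ℝ → ℝ → ℝ → ℝ :=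
  24 * S.D₂ * dx S.A₁ + 24 * S.D₁ * dx S.A₂
    - 6 * S.D₂ * df S.B₁ - 6 * S.D₂ * dg S.B₂ - 6 * S.D₁ * df S.B₂ + 6 * S.D₁ * dg S.B₁
    + 12 * S.A₂ * dx S.D₁ + 12 * S.A₁ * dx S.D₂
    + 4 * dx (dx S.B₂) - 4 * df (dx S.C₂) + 4 * dg (dx S.C₁)
    - 6 * S.B₂ * df S.D₁ - 6 * S.B₂ * dg S.D₂ - 6 * S.B₁ * df S.D₂ + 6 * S.B₁ * dg S.D₁
    + 3 * df (df S.D₂) - 3 * dg (dg S.D₂) - 6 * dg (df S.D₁)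
    + 4 * S.C₂ * df S.C₁ + 4 * S.C₂ * dg S.C₂ + 4 * S.C₁ * df S.C₂ - 4 * S.C₁ * dg S.C₁
    - 4 * S.C₂ * dx S.B₁ - 4 * S.C₁ * dx S.B₂

end Coeffs

end CplxLin

end

/-! Write the system as the single equation u'' = A u'³ + B u'² + C u' + D. By the Cauchy–Riemann
equations the four real conditions are the real and imaginary parts of `4 * lie₁` and `4 * lie₂`
(`cond_eq_lie₁`, `cond_eq_lie₂`), the two Lie–Tresse invariants of this equation. So it must be
shown that linearizability is equivalent to `lie₁ = lie₂ = 0`.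

Sufficiency. The equation describes the unparametrised geodesics of a projective connection, and the
invariants are its curvature. If they vanish at real `x`, they vanish on a neighbourhood in ℂ² by
the identity theorem (`eventually_eq_zero_of_real`). The linear system for (ψ, ψ_x, ψ_u) attached to
the connection is then integrable (`exists_frame_solution`). It is solved by integrating along rays
from the base point (`exists_analyticAt_radial`) and using flatness to get the remaining directions
(`fderiv_eq_of_flat_of_radial`). Quotients of three independent solutions are coordinates X, Y in
which solutions are straight lines (`exists_isStraighteningAt`), so the system becomes d²Y/dX² = 0.

Necessity. A linear equation has vanishing invariants (`lie_eq_zero_of_linear`), so it too has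
straightening coordinates X, Y. The composites X(χ, U), Y(χ, U) are local coordinates, and any local
coordinates straighten some cubic equation with vanishing invariants
(`exists_straightened_equation`), because the flat connection they define has zero curvature.
Running solutions of the system through a point in all admissible directions shows that this cubic
equation has the same coefficients as the system at real points (`cubic_eq_of_maps_solutions`,
`cubic_coeffs_eq_zero`), whence the conditions. -/

noncomputable section

namespace CplxLin

/-! ### Analytic solutions of linear differential equations along rays. -/

section Radial

open unitInterval BoundedContinuousFunction

variable {E B F : Type*} [NormedAddCommGroup E] [NormedSpace ℂ E]
  [NormedAddCommGroup B] [NormedSpace ℂ B]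
  [NormedAddCommGroup F] [NormedSpace ℂ F]

theorem analyticAt_clm_apply {f : E → B →L[ℂ] F} {g : E → B} {z : E} (hf : AnalyticAt ℂ f z)
    (hg : AnalyticAt ℂ g z) : AnalyticAt ℂ (fun w => f w (g w)) z :=
  AnalyticAt.comp (f := fun w => (f w, g w))
    (ContinuousLinearMap.analyticAt_bilinear (ContinuousLinearMap.id ℂ (B →L[ℂ] F)) _)
    (hf.prod hg)

/-- The continuous linear map sending `b` to the path `s ↦ s ^ n • b`. -/
def powPath (B : Type*) [NormedAddCommGroup B] [NormedSpace ℂ B] (n : ℕ) : B →L[ℂ] (I →ᵇ B) :=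
  LinearMap.mkContinuous
    { toFun := fun b => mkOfCompact ⟨fun s => (((s : ℝ) : ℂ) ^ n) • b, by fun_prop⟩
      map_add' := fun b c => by ext s; simp
      map_smul' := fun a b => by ext s; simp [smul_smul, mul_comm] } 1 <| fun b => by
    rw [one_mul, BoundedContinuousFunction.norm_le (norm_nonneg b)]
    intro s
    have hs : ‖((s : ℝ) : ℂ) ^ n‖ ≤ 1 := by
      rw [norm_pow, Complex.norm_real, Real.norm_of_nonneg s.2.1]
      exact pow_le_one₀ s.2.1 s.2.2
    calc ‖(((s : ℝ) : ℂ) ^ n) • b‖ = ‖((s : ℝ) : ℂ) ^ n‖ * ‖b‖ := norm_smul _ _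
      _ ≤ ‖b‖ := mul_le_of_le_one_left (norm_nonneg b) hs

theorem powPath_apply (n : ℕ) (b : B) (s : I) : powPath B n b s = (((s : ℝ) : ℂ) ^ n) • b := rfl

theorem norm_powPath_le (n : ℕ) : ‖powPath B n‖ ≤ 1 :=
  LinearMap.mkContinuous_norm_le _ zero_le_one _

/-- If `Θ` is analytic at the origin then so is the map sending `z` to the path `s ↦ Θ (s z)`. -/
theorem exists_analyticAt_path [CompleteSpace B] {Θ : E → B} (h : AnalyticAt ℂ Θ 0) :
    ∃ G : E → (I →ᵇ B), AnalyticAt ℂ G 0 ∧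
      ∀ᶠ z in 𝓝 (0 : E), ∀ s : I, G z s = Θ (((s : ℝ) : ℂ) • z) := by
  obtain ⟨p, r, hp⟩ := h
  -- The homogeneous term of degree n scales by sⁿ along the ray, and |sⁿ| ≤ 1 on the unit interval,
  -- so passing to paths does not decrease the radius of convergence.
  let q : FormalMultilinearSeries ℂ E (I →ᵇ B) :=
    fun n => (powPath B n).compContinuousMultilinearMap (p n)
  have hqn : ∀ n, ‖q n‖ ≤ ‖p n‖ := fun n =>
    (ContinuousLinearMap.norm_compContinuousMultilinearMap_le _ _).trans
      (mul_le_of_le_one_left (norm_nonneg _) (norm_powPath_le n))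
  have hrad : p.radius ≤ q.radius := FormalMultilinearSeries.radius_le_of_le hqn
  have hq : 0 < q.radius := lt_of_lt_of_le hp.radius_pos hrad
  have hsum := q.hasFPowerSeriesOnBall hq
  refine ⟨q.sum, hsum.analyticAt, ?_⟩
  filter_upwards [Metric.eball_mem_nhds (0 : E) hp.r_pos] with z hz s
  have h1 := hsum.hasSum (Metric.eball_subset_eball (hp.r_le.trans hrad) hz)
  rw [zero_add] at h1
  have h2 := (BoundedContinuousFunction.evalCLM ℂ s : (I →ᵇ B) →L[ℂ] B).hasSum h1
  have hz' : ((s : ℝ) : ℂ) • z ∈ Metric.eball (0 : E) r := by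
    rw [Metric.mem_eball, edist_zero_right] at hz ⊢
    refine lt_of_le_of_lt ?_ hz
    rw [enorm_smul]
    refine mul_le_of_le_one_left zero_le ?_
    rw [← ofReal_norm, Complex.norm_real, Real.norm_of_nonneg s.2.1]
    exact ENNReal.ofReal_le_one.2 s.2.2
  have h3 := hp.hasSum hz'
  rw [zero_add] at h3
  refine h2.unique (h3.congr_fun ?_)
  intro n
  rw [ContinuousMultilinearMap.map_smul_univ]
  simp [q, powPath_apply, BoundedContinuousFunction.evalCLM]

/-- The Volterra operator `Y ↦ (t ↦ ∫ s in 0..t, Y s)` on continuous paths. -/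
def volterra (F : Type*) [NormedAddCommGroup F] [NormedSpace ℂ F] : (I →ᵇ F) →L[ℂ] (I →ᵇ F) :=
  LinearMap.mkContinuous
    { toFun := fun Y => mkOfCompact ⟨fun t => ∫ s in (0 : ℝ)..t, IccExtend zero_le_one Y s, by
        have h : Continuous (IccExtend (zero_le_one : (0 : ℝ) ≤ 1) Y) := Y.continuous.Icc_extend'
        exact (intervalIntegral.continuous_primitive (fun a b => h.intervalIntegrable a b) 0).comp
          continuous_subtype_val⟩
      map_add' := fun Y Z => by
        ext t
        have hY : Continuous (IccExtend (zero_le_one : (0 : ℝ) ≤ 1) Y) := Y.continuous.Icc_extend'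
        have hZ : Continuous (IccExtend (zero_le_one : (0 : ℝ) ≤ 1) Z) := Z.continuous.Icc_extend'
        exact intervalIntegral.integral_add (hY.intervalIntegrable 0 t) (hZ.intervalIntegrable 0 t)
      map_smul' := fun a Y => by
        ext t
        exact intervalIntegral.integral_smul a (IccExtend (zero_le_one : (0 : ℝ) ≤ 1) Y) } 1 <|
    fun Y => by
      rw [one_mul, BoundedContinuousFunction.norm_le (norm_nonneg Y)]
      intro t
      have := intervalIntegral.norm_integral_le_of_norm_le_const (a := 0) (b := (t : ℝ))
        (f := IccExtend (zero_le_one : (0 : ℝ) ≤ 1) Y) (C := ‖Y‖)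
        (fun s _ => Y.norm_coe_le_norm _)
      refine this.trans ?_
      rw [sub_zero, abs_of_nonneg t.2.1]
      exact mul_le_of_le_one_right (norm_nonneg Y) t.2.2

theorem volterra_apply (Y : (I →ᵇ F)) (t : I) :
    volterra F Y t = ∫ s in (0 : ℝ)..t, IccExtend zero_le_one Y s := rfl

/-- Pointwise application of a path of operators to a path of vectors. -/
def applyPath (E F : Type*) [NormedAddCommGroup E] [NormedSpace ℂ E]
    [NormedAddCommGroup F] [NormedSpace ℂ F] :
    (I →ᵇ (E →L[ℂ] F)) →L[ℂ] (I →ᵇ E) →L[ℂ] (I →ᵇ F) :=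
  LinearMap.mkContinuous₂
    (LinearMap.mk₂ ℂ
      (fun (G : (I →ᵇ (E →L[ℂ] F))) (Y : (I →ᵇ E)) =>
        (mkOfCompact ⟨fun s => G s (Y s), by fun_prop⟩ : (I →ᵇ F)))
      (fun _ _ _ => by ext; simp) (fun _ _ _ => by ext; simp)
      (fun _ _ _ => by ext; simp) (fun _ _ _ => by ext; simp)) 1 <| fun G Y => by
    rw [one_mul, LinearMap.mk₂_apply, BoundedContinuousFunction.norm_le (by positivity)]
    intro s
    exact (G s).le_of_opNorm_le_of_le (G.norm_coe_le_norm s) (Y.norm_coe_le_norm s)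

theorem applyPath_apply (G : (I →ᵇ (E →L[ℂ] F))) (Y : (I →ᵇ E)) (s : I) :
    applyPath E F G Y s = G s (Y s) := rfl

/-- A linear differential equation along the rays through the origin, with analytic coefficients,
has an analytic solution with any prescribed value at the origin. -/
theorem exists_analyticAt_radial [CompleteSpace F] {Θ : E → E →L[ℂ] F →L[ℂ] F}
    (hΘ : AnalyticAt ℂ Θ 0) (y₀ : F) :
    ∃ Y : E → F, AnalyticAt ℂ Y 0 ∧ Y 0 = y₀ ∧
      ∀ᶠ z in 𝓝 (0 : E), fderiv ℂ Y z z = Θ z z (Y z) := by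
  obtain ⟨G, hG, hGΘ⟩ := exists_analyticAt_path hΘ
  -- `G' z` is the path s ↦ Θ(sz) z, as `powPath _ 0` makes constant paths. On the ray through z the
  -- equation reads Y = c + T z Y, a Volterra equation whose operator is analytic in z.
  let G' : E → (I →ᵇ (F →L[ℂ] F)) := fun z => applyPath E (F →L[ℂ] F) (G z) (powPath E 0 z)
  let T : E → (I →ᵇ F) →L[ℂ] (I →ᵇ F) := fun z => (volterra F).comp (applyPath F F (G' z))
  let c : (I →ᵇ F) := powPath F 0 y₀
  have hG' : AnalyticAt ℂ G' 0 :=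
    analyticAt_clm_apply
      (AnalyticAt.comp (g := applyPath E (F →L[ℂ] F)) (ContinuousLinearMap.analyticAt _ _) hG)
      ((powPath E 0).analyticAt _)
  have hT : AnalyticAt ℂ T 0 := by
    have h1 : AnalyticAt ℂ (fun z => applyPath F F (G' z)) 0 :=
      AnalyticAt.comp (g := applyPath F F) (ContinuousLinearMap.analyticAt _ _) hG'
    exact ((ContinuousLinearMap.compL ℂ (I →ᵇ F) (I →ᵇ F) (I →ᵇ F) (volterra F)).analyticAt _).comp h1
  -- The direction z enters linearly, so T vanishes at the origin. Hence 1 - T z is invertible for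
  -- small z and its inverse is analytic there.
  have hT0 : T 0 = 0 := by
    simp [T, G']
  have hunit : ∀ᶠ z in 𝓝 (0 : E), ‖T z‖ < 1 := by
    have h := hT.continuousAt.norm
    rw [ContinuousAt, hT0, norm_zero] at h
    exact h.eventually_lt_const one_pos
  let Y : E → (I →ᵇ F) := fun z => Ring.inverse (1 - T z) c
  have hY : AnalyticAt ℂ Y 0 := by
    have h1 : AnalyticAt ℂ (fun z => (1 : (I →ᵇ F) →L[ℂ] (I →ᵇ F)) - T z) 0 :=
      analyticAt_const.sub hT
    have h2 : AnalyticAt ℂ (Ring.inverse : ((I →ᵇ F) →L[ℂ] (I →ᵇ F)) → _) (1 - T 0) := by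
      rw [hT0, sub_zero]
      exact analyticAt_inverse (1 : ((I →ᵇ F) →L[ℂ] (I →ᵇ F))ˣ)
    exact analyticAt_clm_apply (AnalyticAt.comp (f := fun z => 1 - T z) h2 h1) analyticAt_const
  have hfix : ∀ z, ‖T z‖ < 1 → Y z = c + T z (Y z) := by
    intro z hz
    have hu : IsUnit (1 - T z) := isUnit_one_sub_of_norm_lt_one hz
    have := congrArg (fun A : (I →ᵇ F) →L[ℂ] (I →ᵇ F) => A c) (Ring.mul_inverse_cancel _ hu)
    simp only [mul_apply_eq_comp, _root_.sub_apply,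
      one_apply_eq_self] at this
    exact eq_add_of_sub_eq this
  have huniq : ∀ z, ‖T z‖ < 1 → ∀ Z : (I →ᵇ F), Z = c + T z Z → Z = Y z := by
    intro z hz Z hZ
    have hu : IsUnit (1 - T z) := isUnit_one_sub_of_norm_lt_one hz
    have := congrArg (fun A : (I →ᵇ F) →L[ℂ] (I →ᵇ F) => A Z) (Ring.inverse_mul_cancel _ hu)
    simp only [mul_apply_eq_comp, _root_.sub_apply,
      one_apply_eq_self] at this
    rw [← this, sub_eq_of_eq_add hZ]
  obtain ⟨δ, hδ, hball⟩ := Metric.eventually_nhds_iff_ball.1 (hGΘ.and hunit)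
  have hG'Θ : ∀ z ∈ Metric.ball (0 : E) δ, ∀ s : I, G' z s = Θ (((s : ℝ) : ℂ) • z) z := by
    intro z hz s
    simp [G', applyPath_apply, powPath_apply, (hball z hz).1 s]
  have hint : ∀ z ∈ Metric.ball (0 : E) δ, ∀ t : I, Y z t = y₀ + ∫ s in (0 : ℝ)..t,
      IccExtend zero_le_one (applyPath F F (G' z) (Y z)) s := by
    intro z hz t
    have := congrArg (fun Z : (I →ᵇ F) => Z t) (hfix z (hball z hz).2)
    simpa [c, powPath_apply, T, volterra_apply] using this
  have hscale : ∀ z ∈ Metric.ball (0 : E) δ, ∀ t : I, ((t : ℝ) : ℂ) • z ∈ Metric.ball (0 : E) δ := by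
    intro z hz t
    rw [mem_ball_zero_iff] at hz ⊢
    refine lt_of_le_of_lt ?_ hz
    rw [norm_smul, Complex.norm_real, Real.norm_of_nonneg t.2.1]
    exact mul_le_of_le_one_left (norm_nonneg z) t.2.2
  -- The path s ↦ Y z (ts) solves the integral equation belonging to tz, by substitution in the
  -- integral; uniqueness identifies the two. The paths thus come from one function of the point,
  -- their value at time 1.
  have hray : ∀ z ∈ Metric.ball (0 : E) δ, ∀ t : I, Y z t = Y (((t : ℝ) : ℂ) • z) 1 := by
    intro z hz t
    let Z : (I →ᵇ F) := mkOfCompact ⟨fun s => Y z (t * s), by fun_prop⟩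
    have hZ : Z = Y (((t : ℝ) : ℂ) • z) := by
      refine huniq _ (hball _ (hscale z hz t)).2 Z ?_
      ext s
      change Y z (t * s) = _
      rw [hint z hz]
      simp only [BoundedContinuousFunction.add_apply, c, powPath_apply, pow_zero, one_smul, T,
        ContinuousLinearMap.comp_apply, volterra_apply]
      congr 1
      have hsub := intervalIntegral.smul_integral_comp_mul_left
        (IccExtend zero_le_one (applyPath F F (G' z) (Y z))) (t : ℝ) (a := 0) (b := (s : ℝ))
      rw [mul_zero] at hsub
      rw [Icc.coe_mul, ← hsub, ← intervalIntegral.integral_smul]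
      refine intervalIntegral.integral_congr ?_
      intro r hr
      rw [uIcc_of_le s.2.1] at hr
      have hrI : r ∈ Icc (0 : ℝ) 1 := ⟨hr.1, hr.2.trans s.2.2⟩
      have htr : (t : ℝ) * r ∈ Icc (0 : ℝ) 1 := (t * ⟨r, hrI⟩ : I).2
      change (t : ℝ) • IccExtend _ _ ((t : ℝ) * r) = IccExtend _ _ r
      rw [IccExtend_of_mem _ _ hrI, IccExtend_of_mem _ _ htr, applyPath_apply (G' z), applyPath_apply (G' _),
        hG'Θ _ (hscale z hz t)]
      rw [hG'Θ z hz]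
      have : Z ⟨r, hrI⟩ = Y z ⟨(t : ℝ) * r, htr⟩ := rfl
      rw [this, smul_smul, map_smul, ← Complex.coe_smul]
      simp [mul_comm]
    rw [← hZ]
    simp [Z]
  have hY1 : AnalyticAt ℂ (fun z => Y z 1) 0 :=
    ((BoundedContinuousFunction.evalCLM ℂ (1 : I) : (I →ᵇ F) →L[ℂ] F).analyticAt _).comp hY
  refine ⟨fun z => Y z 1, hY1, ?_, ?_⟩
  · have h0 : (0 : E) ∈ Metric.ball (0 : E) δ := Metric.mem_ball_self hδ
    have := hint 0 h0 0
    have h1 := hray 0 h0 0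
    simp only [smul_zero] at h1
    change Y 0 1 = y₀
    rw [← h1, this]
    simp
  · filter_upwards [hY1.eventually_analyticAt, Metric.ball_mem_nhds (0 : E) (half_pos hδ)]
      with w hw hwδ
    -- Placing w at the midpoint of the ray to 2w gives it an interior parameter, where the integral
    -- has a two-sided derivative. The factor 2 cancels at the end.
    have hz : (2 : ℂ) • w ∈ Metric.ball (0 : E) δ := by
      rw [mem_ball_zero_iff] at hwδ ⊢
      rw [norm_smul, Complex.norm_two]
      linarith
    set z := (2 : ℂ) • w with hzdef
    have hhalf : ((1 / 2 : ℝ) : ℂ) • z = w := by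
      rw [hzdef, smul_smul]; norm_num
    have hmem : (1 / 2 : ℝ) ∈ Icc (0 : ℝ) 1 := by constructor <;> norm_num
    have hcont : Continuous (IccExtend (zero_le_one : (0 : ℝ) ≤ 1) (applyPath F F (G' z) (Y z))) :=
      (applyPath F F (G' z) (Y z)).continuous.Icc_extend'
    have hd1 : HasDerivAt (fun t : ℝ => y₀ + ∫ s in (0 : ℝ)..t,
        IccExtend zero_le_one (applyPath F F (G' z) (Y z)) s)
        (IccExtend zero_le_one (applyPath F F (G' z) (Y z)) (1 / 2)) (1 / 2) :=
      (hcont.integral_hasStrictDerivAt 0 (1 / 2)).hasDerivAt.const_add y₀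
    have hd2 : HasDerivAt (fun t : ℝ => Y ((t : ℂ) • z) 1) (fderiv ℂ (fun z => Y z 1) w z)
        (1 / 2) := by
      have hF : HasFDerivAt (fun z => Y z 1) (fderiv ℂ (fun z => Y z 1) w)
          (((1 / 2 : ℝ) : ℂ) • z) := by
        rw [hhalf]; exact hw.differentiableAt.hasFDerivAt
      have hl : HasDerivAt (fun t : ℝ => (t : ℂ) • z) z (1 / 2) := by
        simpa using (Complex.ofRealCLM.hasDerivAt (x := (1 / 2 : ℝ))).smul_const z
      exact (hF.restrictScalars ℝ).comp_hasDerivAt (1 / 2 : ℝ) hl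
    have heq : (fun t : ℝ => Y ((t : ℂ) • z) 1) =ᶠ[𝓝 (1 / 2)] fun t : ℝ => y₀ +
        ∫ s in (0 : ℝ)..t, IccExtend zero_le_one (applyPath F F (G' z) (Y z)) s := by
      filter_upwards [Icc_mem_nhds (show (0 : ℝ) < 1 / 2 by norm_num)
        (show (1 / 2 : ℝ) < 1 by norm_num)] with t ht
      rw [← hint z hz ⟨t, ht⟩, hray z hz ⟨t, ht⟩]
    have hkey := hd2.unique (hd1.congr_of_eventuallyEq heq)
    rw [IccExtend_of_mem _ _ hmem, applyPath_apply, hG'Θ z hz, hray z hz] at hkey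
    simp only [hhalf] at hkey
    rw [hzdef, map_smul, map_smul] at hkey
    exact smul_right_injective F (two_ne_zero (α := ℂ)) hkey

end Radial

/-! ### Flat linear Pfaffian systems. -/

section Flat

variable {E F : Type*} [NormedAddCommGroup E] [NormedSpace ℂ E]
  [NormedAddCommGroup F] [NormedSpace ℂ F]

theorem hasDerivAt_comp_ray {G : Type*} [NormedAddCommGroup G] [NormedSpace ℂ G] {f : E → G}
    {z : E} {t : ℝ} (hf : DifferentiableAt ℂ f ((t : ℂ) • z)) :
    HasDerivAt (fun t : ℝ => f ((t : ℂ) • z)) (fderiv ℂ f ((t : ℂ) • z) z) t := by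
  have hl : HasDerivAt (fun t : ℝ => (t : ℂ) • z) z t := by
    simpa using (Complex.ofRealCLM.hasDerivAt (x := t)).smul_const z
  exact (hf.hasFDerivAt.restrictScalars ℝ).comp_hasDerivAt t hl

/-- A radial solution of a flat linear Pfaffian system is a solution. -/
theorem fderiv_eq_of_flat_of_radial [CompleteSpace F] {Θ : E → E →L[ℂ] F →L[ℂ] F}
    (hΘ : AnalyticAt ℂ Θ 0)
    (hflat : ∀ᶠ z in 𝓝 (0 : E), ∀ v w y, fderiv ℂ Θ z v w y + Θ z w (Θ z v y) =
      fderiv ℂ Θ z w v y + Θ z v (Θ z w y))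
    {Y : E → F} (hY : AnalyticAt ℂ Y 0)
    (hrad : ∀ᶠ z in 𝓝 (0 : E), fderiv ℂ Y z z = Θ z z (Y z)) :
    ∀ᶠ z in 𝓝 (0 : E), ∀ v, fderiv ℂ Y z v = Θ z v (Y z) := by
  obtain ⟨δ, hδ, hball⟩ := Metric.eventually_nhds_iff_ball.1
    ((hΘ.eventually_analyticAt.and hY.eventually_analyticAt).and
      (hflat.and (hrad.and hrad.eventually_nhds)))
  have hscale : ∀ z ∈ Metric.ball (0 : E) δ, ∀ t ∈ Icc (0 : ℝ) 1,
      (t : ℂ) • z ∈ Metric.ball (0 : E) δ := by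
    intro z hz t ht
    rw [mem_ball_zero_iff] at hz ⊢
    refine lt_of_le_of_lt ?_ hz
    rw [norm_smul, Complex.norm_real, Real.norm_of_nonneg ht.1]
    exact mul_le_of_le_one_left (norm_nonneg z) ht.2
  -- This is the radial identity differentiated in the direction v; the terms without second
  -- derivatives or `fderiv ℂ Θ` include those from differentiating the direction w itself.
  have hdiff : ∀ w ∈ Metric.ball (0 : E) δ, ∀ v,
      fderiv ℂ (fderiv ℂ Y) w w v + fderiv ℂ Y w v =
        fderiv ℂ Θ w v w (Y w) + Θ w v (Y w) + Θ w w (fderiv ℂ Y w v) := by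
    intro w hw v
    obtain ⟨⟨hΘw, hYw⟩, -, -, hev⟩ := hball w hw
    have hid : HasFDerivAt (fun z : E => z) (ContinuousLinearMap.id ℂ E) w := hasFDerivAt_id w
    have h1 := (hYw.fderiv.differentiableAt.hasFDerivAt).clm_apply hid
    have h2 := ((hΘw.differentiableAt.hasFDerivAt).clm_apply hid).clm_apply
      hYw.differentiableAt.hasFDerivAt
    have h3 := h1.unique (h2.congr_of_eventuallyEq hev)
    have h4 := congrArg (fun A : E →L[ℂ] F => A v) h3
    have hsymm : fderiv ℂ (fderiv ℂ Y) w w v = fderiv ℂ (fderiv ℂ Y) w v w :=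
      (hYw.contDiffAt.isSymmSndFDerivAt_of_omega) w v
    rw [hsymm]
    simp at h4
    rw [add_comm, h4]
    abel
  filter_upwards [Metric.ball_mem_nhds (0 : E) hδ] with z hz v
  -- The defect of the equation in the direction v, weighted by t to absorb the extra terms of
  -- `hdiff`. By flatness it solves the homogeneous linear equation e' = Θ(tz) z e with e(0) = 0, so
  -- it vanishes by Grönwall's inequality.
  let e : ℝ → F := fun t => (t : ℂ) • (fderiv ℂ Y ((t : ℂ) • z) v -
    Θ ((t : ℂ) • z) v (Y ((t : ℂ) • z)))
  have he : ∀ t ∈ Icc (0 : ℝ) 1, HasDerivAt e (Θ ((t : ℂ) • z) z (e t)) t := by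
    intro t ht
    obtain ⟨⟨hΘw, hYw⟩, hfl, hr, -⟩ := hball _ (hscale z hz t ht)
    have hD := hasDerivAt_comp_ray hYw.fderiv.differentiableAt
    have hYd := hasDerivAt_comp_ray hYw.differentiableAt
    have hΘd := hasDerivAt_comp_ray hΘw.differentiableAt
    have hD' : HasDerivAt (fun t : ℝ => fderiv ℂ Y ((t : ℂ) • z) v)
        (fderiv ℂ (fderiv ℂ Y) ((t : ℂ) • z) z v) t :=
      ((ContinuousLinearMap.apply ℂ F v).restrictScalars ℝ).hasFDerivAt.comp_hasDerivAt t hD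
    have hΘ' : HasDerivAt (fun t : ℝ => Θ ((t : ℂ) • z) v)
        (fderiv ℂ Θ ((t : ℂ) • z) z v) t :=
      HasFDerivAt.comp_hasDerivAt t (l := fun A : E →L[ℂ] F →L[ℂ] F => A v)
        (((ContinuousLinearMap.apply ℂ (F →L[ℂ] F) v).restrictScalars ℝ).hasFDerivAt) hΘd
    have hΘY : HasDerivAt (fun t : ℝ => Θ ((t : ℂ) • z) v (Y ((t : ℂ) • z)))
        (fderiv ℂ Θ ((t : ℂ) • z) z v (Y ((t : ℂ) • z)) +
          Θ ((t : ℂ) • z) v (fderiv ℂ Y ((t : ℂ) • z) z)) t := by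
      have hL : HasDerivAt (fun t : ℝ => (Θ ((t : ℂ) • z) v).restrictScalars ℝ)
          ((fderiv ℂ Θ ((t : ℂ) • z) z v).restrictScalars ℝ) t :=
        (ContinuousLinearMap.restrictScalarsL ℂ F F ℝ ℝ).hasFDerivAt.comp_hasDerivAt t hΘ'
      exact hL.clm_apply hYd
    have ht' : HasDerivAt (fun t : ℝ => (t : ℂ)) 1 t := Complex.ofRealCLM.hasDerivAt
    have hprod := ht'.smul (hD'.sub hΘY)
    refine hprod.congr_deriv ?_
    have hd := hdiff _ (hscale z hz t ht) v
    have hf := congrArg (fun y => (t : ℂ) • y) (hfl v z (Y ((t : ℂ) • z)))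
    have hr2 := congrArg (fun y => Θ ((t : ℂ) • z) v y) hr
    simp only [map_smul, _root_.smul_apply, smul_add] at hd hf hr2
    simp only [e, map_smul, map_sub, one_smul, smul_sub, smul_add, hr2, Pi.sub_apply]
    generalize Y ((t : ℂ) • z) = y at *
    rw [← sub_eq_zero] at hd hf ⊢
    have : ∀ p q r : F, p = 0 → q = 0 → r = p + q → r = 0 := by
      rintro p q r rfl rfl h; simpa using h
    exact this _ _ _ hd hf (by abel)
  have hΘc : ContinuousOn (fun t : ℝ => Θ ((t : ℂ) • z) z) (Icc 0 1) := by
    intro t ht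
    have h1 := (hasDerivAt_comp_ray (hball _ (hscale z hz t ht)).1.1.differentiableAt).continuousAt
    exact ((ContinuousLinearMap.apply ℂ (F →L[ℂ] F) z).continuous.continuousAt.comp
      h1).continuousWithinAt
  obtain ⟨K, hK⟩ := isCompact_Icc.exists_bound_of_continuousOn hΘc
  have hzero := eq_zero_of_abs_deriv_le_mul_abs_self_of_eq_zero_right (f := e) (K := K)
    (fun t ht => (he t ht).continuousAt.continuousWithinAt)
    (fun t ht => (he t (Ico_subset_Icc_self ht)).hasDerivWithinAt) (by simp [e])
    (fun t ht => ContinuousLinearMap.le_of_opNorm_le _ (hK t (Ico_subset_Icc_self ht)) _) 1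
    (right_mem_Icc.2 zero_le_one)
  simpa [e, sub_eq_zero] using hzero

/-- Local solvability of flat linear Pfaffian systems in the analytic category. -/
theorem exists_analyticAt_flat [CompleteSpace F] {Θ : E → E →L[ℂ] F →L[ℂ] F} {z₀ : E}
    (hΘ : AnalyticAt ℂ Θ z₀)
    (hflat : ∀ᶠ z in 𝓝 z₀, ∀ v w y, fderiv ℂ Θ z v w y + Θ z w (Θ z v y) =
      fderiv ℂ Θ z w v y + Θ z v (Θ z w y)) (y₀ : F) :
    ∃ Y : E → F, AnalyticAt ℂ Y z₀ ∧ Y z₀ = y₀ ∧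
      ∀ᶠ z in 𝓝 z₀, ∀ v, fderiv ℂ Y z v = Θ z v (Y z) := by
  have hadd : Tendsto (fun z => z₀ + z) (𝓝 0) (𝓝 z₀) := by
    simpa using Continuous.tendsto (show Continuous fun z : E => z₀ + z by fun_prop) 0
  have hsub : Tendsto (fun z => z - z₀) (𝓝 z₀) (𝓝 0) := by
    simpa using Continuous.tendsto (show Continuous fun z : E => z - z₀ by fun_prop) z₀
  have hΘ' : AnalyticAt ℂ (fun z => Θ (z₀ + z)) 0 := by
    refine AnalyticAt.comp (f := fun z => z₀ + z) ?_ (analyticAt_const.add analyticAt_id)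
    simpa using hΘ
  obtain ⟨Y, hY, hY0, hrad⟩ := exists_analyticAt_radial hΘ' y₀
  have hflat' : ∀ᶠ z in 𝓝 (0 : E), ∀ v w y, fderiv ℂ (fun z => Θ (z₀ + z)) z v w y +
      Θ (z₀ + z) w (Θ (z₀ + z) v y) = fderiv ℂ (fun z => Θ (z₀ + z)) z w v y +
      Θ (z₀ + z) v (Θ (z₀ + z) w y) := by
    filter_upwards [hadd.eventually hflat] with z hz
    intro v w y
    rw [show fderiv ℂ (fun z => Θ (z₀ + z)) z = fderiv ℂ Θ (z₀ + z) from
      fderiv_comp_add_left (𝕜 := ℂ) (f := Θ) (x := z) z₀]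
    exact hz v w y
  have hsol := fderiv_eq_of_flat_of_radial hΘ' hflat' hY hrad
  refine ⟨fun z => Y (z - z₀), ?_, by simpa using hY0, ?_⟩
  · refine AnalyticAt.comp (f := fun z => z - z₀) ?_ (analyticAt_id.sub analyticAt_const)
    simpa using hY
  · filter_upwards [hsub.eventually hsol] with z hz v
    rw [fderiv_comp_sub, hz]
    simp

theorem analyticAt_add_sum_smul {B ι : Type*} [NormedAddCommGroup B] [NormedSpace ℂ B] [Fintype ι]
    (k₀ : B) (k : ι → B) {φ : ι → E → ℂ} {z : E} (hφ : ∀ i, AnalyticAt ℂ (φ i) z) :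
    AnalyticAt ℂ (fun z => k₀ + ∑ i, φ i z • k i) z :=
  analyticAt_const.add (Finset.analyticAt_fun_sum _ fun i _ => (hφ i).smul analyticAt_const)

theorem fderiv_add_sum_smul {B ι : Type*} [NormedAddCommGroup B] [NormedSpace ℂ B] [Fintype ι]
    (k₀ : B) (k : ι → B) {φ : ι → E → ℂ} {z : E} (hφ : ∀ i, AnalyticAt ℂ (φ i) z) (v : E) :
    fderiv ℂ (fun z => k₀ + ∑ i, φ i z • k i) z v = ∑ i, fderiv ℂ (φ i) z v • k i := by
  have hd : HasFDerivAt (fun z => k₀ + ∑ i, φ i z • k i)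
      (∑ i, (fderiv ℂ (φ i) z).smulRight (k i)) z :=
    (HasFDerivAt.fun_sum fun i _ =>
      (hφ i).differentiableAt.hasFDerivAt.smul_const (k i)).const_add k₀
  rw [hd.fderiv]
  simp

/-- Local solvability of flat linear Pfaffian systems whose form `T` is an affine combination of
constant forms with analytic coefficients `φ i`. -/
theorem exists_analyticAt_flat_sum [CompleteSpace F] {ι : Type*} [Fintype ι]
    (K₀ : E →L[ℂ] F →L[ℂ] F) (K : ι → E →L[ℂ] F →L[ℂ] F) {φ : ι → E → ℂ} {z₀ : E}
    (hφ : ∀ i, AnalyticAt ℂ (φ i) z₀) {T : E → E → F → F}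
    (hT : ∀ z v y, K₀ v y + ∑ i, φ i z • K i v y = T z v y)
    (hflat : ∀ᶠ z in 𝓝 z₀, ∀ v w y,
      (∑ i, fderiv ℂ (φ i) z v • K i w y) + T z w (T z v y) =
        (∑ i, fderiv ℂ (φ i) z w • K i v y) + T z v (T z w y)) (y₀ : F) :
    ∃ Y : E → F, AnalyticAt ℂ Y z₀ ∧ Y z₀ = y₀ ∧
      ∀ᶠ z in 𝓝 z₀, ∀ v, fderiv ℂ Y z v = T z v (Y z) := by
  let Θ : E → E →L[ℂ] F →L[ℂ] F := fun z => K₀ + ∑ i, φ i z • K i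
  have hΘT : ∀ z v y, Θ z v y = T z v y := by
    intro z v y
    rw [← hT]
    simp [Θ]
  have hΘ : AnalyticAt ℂ Θ z₀ := analyticAt_add_sum_smul K₀ K hφ
  have hflat' : ∀ᶠ z in 𝓝 z₀, ∀ v w y, fderiv ℂ Θ z v w y + Θ z w (Θ z v y) =
      fderiv ℂ Θ z w v y + Θ z v (Θ z w y) := by
    filter_upwards [hflat, eventually_all.2 fun i => (hφ i).eventually_analyticAt] with z hz hφz
    have hd' : ∀ v w y, fderiv ℂ Θ z v w y = ∑ i, fderiv ℂ (φ i) z v • K i w y := by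
      intro v w y
      have h : fderiv ℂ Θ z v = ∑ i, fderiv ℂ (φ i) z v • K i := fderiv_add_sum_smul K₀ K hφz v
      rw [h]
      simp
    intro v w y
    simp only [hΘT, hd']
    exact hz v w y
  obtain ⟨Y, hY, hY0, hsol⟩ := exists_analyticAt_flat hΘ hflat' y₀
  refine ⟨Y, hY, hY0, ?_⟩
  filter_upwards [hsol] with z hz v
  rw [hz, hΘT]

end Flat

/-! ### Calculus of partial derivatives, and the relative invariants. -/

/-- Partial derivative of a function of `(x, u)` in the direction of `x`. -/
def pdx (F : ℂ × ℂ → ℂ) (z : ℂ × ℂ) : ℂ := fderiv ℂ F z (1, 0)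

/-- Partial derivative of a function of `(x, u)` in the direction of `u`. -/
def pdu (F : ℂ × ℂ → ℂ) (z : ℂ × ℂ) : ℂ := fderiv ℂ F z (0, 1)

/-- `F` is differentiable at `z` with partial derivatives `d` and `e`. -/
def HasPartials (F : ℂ × ℂ → ℂ) (d e : ℂ) (z : ℂ × ℂ) : Prop :=
  HasFDerivAt F (d • ContinuousLinearMap.fst ℂ ℂ ℂ + e • ContinuousLinearMap.snd ℂ ℂ ℂ) z

theorem fderiv_apply_eq (F : ℂ × ℂ → ℂ) (z v : ℂ × ℂ) :
    fderiv ℂ F z v = v.1 * pdx F z + v.2 * pdu F z := by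
  have hv : v = v.1 • ((1, 0) : ℂ × ℂ) + v.2 • ((0, 1) : ℂ × ℂ) := by
    ext <;> simp
  conv_lhs => rw [hv, map_add, map_smul, map_smul]
  rfl

namespace HasPartials

variable {F G : ℂ × ℂ → ℂ} {d e d' e' : ℂ} {z : ℂ × ℂ}

theorem pdx_eq (h : HasPartials F d e z) : pdx F z = d := by
  rw [pdx, HasFDerivAt.fderiv h]; simp

theorem pdu_eq (h : HasPartials F d e z) : pdu F z = e := by
  rw [pdu, HasFDerivAt.fderiv h]; simp

theorem congr_of_eventuallyEq (h : HasPartials F d e z) (hG : G =ᶠ[𝓝 z] F) :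
    HasPartials G d e z := HasFDerivAt.congr_of_eventuallyEq h hG

theorem add (h : HasPartials F d e z) (h' : HasPartials G d' e' z) :
    HasPartials (fun w => F w + G w) (d + d') (e + e') z := by
  refine (HasFDerivAt.add h h').congr_fderiv ?_
  ext <;> simp

theorem sub (h : HasPartials F d e z) (h' : HasPartials G d' e' z) :
    HasPartials (fun w => F w - G w) (d - d') (e - e') z := by
  refine (HasFDerivAt.sub h h').congr_fderiv ?_
  ext <;> simp

theorem mul (h : HasPartials F d e z) (h' : HasPartials G d' e' z) :
    HasPartials (fun w => F w * G w) (F z * d' + d * G z) (F z * e' + e * G z) z := by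
  refine (HasFDerivAt.mul h h').congr_fderiv ?_
  ext <;> simp [mul_comm]

theorem const_mul (h : HasPartials F d e z) (c : ℂ) :
    HasPartials (fun w => c * F w) (c * d) (c * e) z := by
  refine (HasFDerivAt.const_mul h c).congr_fderiv ?_
  ext <;> simp

end HasPartials

theorem _root_.DifferentiableAt.hasPartials {F : ℂ × ℂ → ℂ} {z : ℂ × ℂ}
    (h : DifferentiableAt ℂ F z) : HasPartials F (pdx F z) (pdu F z) z := by
  refine h.hasFDerivAt.congr_fderiv ?_
  ext <;> simp [pdx, pdu]

theorem _root_.AnalyticAt.hasPartials {F : ℂ × ℂ → ℂ} {z : ℂ × ℂ}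
    (h : AnalyticAt ℂ F z) : HasPartials F (pdx F z) (pdu F z) z :=
  h.differentiableAt.hasPartials

theorem _root_.AnalyticAt.pdx {F : ℂ × ℂ → ℂ} {z : ℂ × ℂ} (h : AnalyticAt ℂ F z) :
    AnalyticAt ℂ (pdx F) z :=
  analyticAt_clm_apply h.fderiv analyticAt_const

theorem _root_.AnalyticAt.pdu {F : ℂ × ℂ → ℂ} {z : ℂ × ℂ} (h : AnalyticAt ℂ F z) :
    AnalyticAt ℂ (pdu F) z :=
  analyticAt_clm_apply h.fderiv analyticAt_const

theorem pdx_pdu_comm {F : ℂ × ℂ → ℂ} {z : ℂ × ℂ} (h : AnalyticAt ℂ F z) :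
    pdx (pdu F) z = pdu (pdx F) z := by
  have hd := h.fderiv.differentiableAt
  have h1 : ∀ v w : ℂ × ℂ, fderiv ℂ (fun y => fderiv ℂ F y w) z v = fderiv ℂ (fderiv ℂ F) z v w := by
    intro v w
    rw [fderiv_clm_apply hd (differentiableAt_const w)]
    simp
  have hs := h.contDiffAt.isSymmSndFDerivAt_of_omega (1, 0) (0, 1)
  calc pdx (pdu F) z = fderiv ℂ (fderiv ℂ F) z (1, 0) (0, 1) := h1 _ _
    _ = fderiv ℂ (fderiv ℂ F) z (0, 1) (1, 0) := hs
    _ = pdu (pdx F) z := (h1 _ _).symm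

theorem _root_.Filter.EventuallyEq.pdx {F G : ℂ × ℂ → ℂ} {z : ℂ × ℂ} (h : F =ᶠ[𝓝 z] G) :
    pdx F =ᶠ[𝓝 z] pdx G := by
  filter_upwards [h.eventually_nhds] with w hw
  rw [CplxLin.pdx, CplxLin.pdx, Filter.EventuallyEq.fderiv_eq hw]

theorem _root_.Filter.EventuallyEq.pdu {F G : ℂ × ℂ → ℂ} {z : ℂ × ℂ} (h : F =ᶠ[𝓝 z] G) :
    pdu F =ᶠ[𝓝 z] pdu G := by
  filter_upwards [h.eventually_nhds] with w hw
  rw [CplxLin.pdu, CplxLin.pdu, Filter.EventuallyEq.fderiv_eq hw]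

/-- The first relative invariant of `u'' = A u'³ + B u'² + C u' + D`. -/
def lie₁ (A B C D : ℂ × ℂ → ℂ) (z : ℂ × ℂ) : ℂ :=
  3 * pdx (pdx A) z + 3 * C z * pdx A z + 3 * A z * pdx C z - 3 * D z * pdu A z
    - 6 * A z * pdu D z + pdu (pdu C) z + B z * pdu C z - 2 * B z * pdx B z - 2 * pdu (pdx B) z

/-- The second relative invariant of `u'' = A u'³ + B u'² + C u' + D`. -/
def lie₂ (A B C D : ℂ × ℂ → ℂ) (z : ℂ × ℂ) : ℂ :=
  6 * D z * pdx A z - 3 * D z * pdu B z + 3 * A z * pdx D z + pdx (pdx B) z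
    - 2 * pdu (pdx C) z - 3 * B z * pdu D z + 3 * pdu (pdu D) z + 2 * C z * pdu C z
    - C z * pdx B z

/-! ### The projective frame system and straightening coordinates. -/

section Frame

/-- Zeroth-order coefficient of `ψ_xx` in the projective frame system. -/
def frameXX (B C D : ℂ × ℂ → ℂ) (z : ℂ × ℂ) : ℂ :=
  pdu D z - (1 / 3) * pdx C z + (2 / 9) * (C z * C z) - (2 / 3) * (B z * D z)

/-- Zeroth-order coefficient of `ψ_xu` in the projective frame system. -/
def frameXU (A B C D : ℂ × ℂ → ℂ) (z : ℂ × ℂ) : ℂ :=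
  (1 / 3) * pdu C z - (1 / 3) * pdx B z + (1 / 9) * (B z * C z) - A z * D z

/-- Zeroth-order coefficient of `ψ_uu` in the projective frame system. -/
def frameUU (A B C : ℂ × ℂ → ℂ) (z : ℂ × ℂ) : ℂ :=
  (1 / 3) * pdu B z - pdx A z + (2 / 9) * (B z * B z) - (2 / 3) * (A z * C z)

/-- The right-hand side of the projective frame system for `y = (ψ, ψ_x, ψ_u)`, in the
direction `v`, with `a, b, c` the zeroth-order coefficients. -/
def frameForm (A B C D a b c : ℂ) (v : ℂ × ℂ) (y : ℂ × ℂ × ℂ) : ℂ × ℂ × ℂ :=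
  (v.1 * y.2.1 + v.2 * y.2.2,
    v.1 * (C / 3 * y.2.1 - D * y.2.2 + a * y.1) + v.2 * (B / 3 * y.2.1 - C / 3 * y.2.2 + b * y.1),
    v.1 * (B / 3 * y.2.1 - C / 3 * y.2.2 + b * y.1) + v.2 * (A * y.2.1 - B / 3 * y.2.2 + c * y.1))

/-- `frameForm` with constant coefficients as a continuous bilinear map. -/
def frameBilin (A B C D a b c : ℂ) : ℂ × ℂ →L[ℂ] (ℂ × ℂ × ℂ) →L[ℂ] (ℂ × ℂ × ℂ) :=
  LinearMap.toContinuousBilinearMap <|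
    LinearMap.mk₂ ℂ (frameForm A B C D a b c)
      (fun _ _ _ => by ext <;> simp [frameForm] <;> ring)
      (fun _ _ _ => by ext <;> simp [frameForm] <;> ring)
      (fun _ _ _ => by ext <;> simp [frameForm] <;> ring)
      (fun _ _ _ => by ext <;> simp [frameForm] <;> ring)

theorem frameBilin_apply (A B C D a b c : ℂ) (v : ℂ × ℂ) (y : ℂ × ℂ × ℂ) :
    frameBilin A B C D a b c v y = frameForm A B C D a b c v y := rfl

end Frame

section Frame

variable {A B C D : ℂ × ℂ → ℂ} {z z₀ : ℂ × ℂ}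

theorem analyticAt_frameXX (hB : AnalyticAt ℂ B z) (hC : AnalyticAt ℂ C z)
    (hD : AnalyticAt ℂ D z) : AnalyticAt ℂ (frameXX B C D) z :=
  (((hD.pdu.sub (analyticAt_const.mul hC.pdx)).add (analyticAt_const.mul (hC.mul hC))).sub
    (analyticAt_const.mul (hB.mul hD)))

theorem analyticAt_frameXU (hA : AnalyticAt ℂ A z) (hB : AnalyticAt ℂ B z)
    (hC : AnalyticAt ℂ C z) (hD : AnalyticAt ℂ D z) : AnalyticAt ℂ (frameXU A B C D) z :=
  ((((analyticAt_const.mul hC.pdu).sub (analyticAt_const.mul hB.pdx)).add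
    (analyticAt_const.mul (hB.mul hC))).sub (hA.mul hD))

theorem analyticAt_frameUU (hA : AnalyticAt ℂ A z) (hB : AnalyticAt ℂ B z)
    (hC : AnalyticAt ℂ C z) : AnalyticAt ℂ (frameUU A B C) z :=
  ((((analyticAt_const.mul hB.pdu).sub hA.pdx).add (analyticAt_const.mul (hB.mul hB))).sub
    (analyticAt_const.mul (hA.mul hC)))

/-- If the relative invariants vanish, the projective frame system is integrable. -/
theorem exists_frame_solution (hA : AnalyticAt ℂ A z₀) (hB : AnalyticAt ℂ B z₀)
    (hC : AnalyticAt ℂ C z₀) (hD : AnalyticAt ℂ D z₀)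
    (h₁ : ∀ᶠ z in 𝓝 z₀, lie₁ A B C D z = 0) (h₂ : ∀ᶠ z in 𝓝 z₀, lie₂ A B C D z = 0)
    (y₀ : ℂ × ℂ × ℂ) :
    ∃ Y : ℂ × ℂ → ℂ × ℂ × ℂ, AnalyticAt ℂ Y z₀ ∧ Y z₀ = y₀ ∧
      ∀ᶠ z in 𝓝 z₀, ∀ v, fderiv ℂ Y z v = frameForm (A z) (B z) (C z) (D z)
        (frameXX B C D z) (frameXU A B C D z) (frameUU A B C z) v (Y z) := by
  -- The form is affine, not linear, in its seven coefficients, since the first component does not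
  -- involve them. Hence the value at zero is subtracted from each basic form.
  refine exists_analyticAt_flat_sum (frameBilin 0 0 0 0 0 0 0)
    (![frameBilin 1 0 0 0 0 0 0 - frameBilin 0 0 0 0 0 0 0,
      frameBilin 0 1 0 0 0 0 0 - frameBilin 0 0 0 0 0 0 0,
      frameBilin 0 0 1 0 0 0 0 - frameBilin 0 0 0 0 0 0 0,
      frameBilin 0 0 0 1 0 0 0 - frameBilin 0 0 0 0 0 0 0,
      frameBilin 0 0 0 0 1 0 0 - frameBilin 0 0 0 0 0 0 0,
      frameBilin 0 0 0 0 0 1 0 - frameBilin 0 0 0 0 0 0 0,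
      frameBilin 0 0 0 0 0 0 1 - frameBilin 0 0 0 0 0 0 0])
    (φ := ![A, B, C, D, frameXX B C D, frameXU A B C D, frameUU A B C])
    (T := fun z => frameForm (A z) (B z) (C z) (D z)
        (frameXX B C D z) (frameXU A B C D z) (frameUU A B C z)) ?_ ?_ ?_ y₀
  · intro i
    fin_cases i
    exacts [hA, hB, hC, hD, analyticAt_frameXX hB hC hD, analyticAt_frameXU hA hB hC hD,
      analyticAt_frameUU hA hB hC]
  · intro z v y
    rw [Fin.sum_univ_seven]
    simp only [Matrix.cons_val, _root_.sub_apply, frameBilin_apply, frameForm]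
    ext <;> simp <;> ring
  · filter_upwards [hA.eventually_analyticAt, hB.eventually_analyticAt, hC.eventually_analyticAt,
      hD.eventually_analyticAt, h₁, h₂] with z hA hB hC hD h₁ h₂ v w y
    have ha : HasPartials (frameXX B C D) _ _ z :=
      (((hD.pdu.hasPartials.sub (hC.pdx.hasPartials.const_mul (1 / 3))).add
        ((hC.hasPartials.mul hC.hasPartials).const_mul (2 / 9))).sub
        ((hB.hasPartials.mul hD.hasPartials).const_mul (2 / 3)))
    have hb : HasPartials (frameXU A B C D) _ _ z :=
      (((hC.pdu.hasPartials.const_mul (1 / 3)).sub (hB.pdx.hasPartials.const_mul (1 / 3))).add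
        ((hB.hasPartials.mul hC.hasPartials).const_mul (1 / 9))).sub
        (hA.hasPartials.mul hD.hasPartials)
    have hc : HasPartials (frameUU A B C) _ _ z :=
      (((hB.pdu.hasPartials.const_mul (1 / 3)).sub hA.pdx.hasPartials).add
        ((hB.hasPartials.mul hB.hasPartials).const_mul (2 / 9))).sub
        ((hA.hasPartials.mul hC.hasPartials).const_mul (2 / 3))
    rw [Fin.sum_univ_seven, Fin.sum_univ_seven]
    simp only [Matrix.cons_val, _root_.sub_apply, frameBilin_apply, fderiv_apply_eq,
      ha.pdx_eq, ha.pdu_eq, hb.pdx_eq, hb.pdu_eq, hc.pdx_eq, hc.pdu_eq, pdx_pdu_comm hB,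
      pdx_pdu_comm hC]
    simp only [lie₁, lie₂] at h₁ h₂
    simp only [frameForm, frameXX, frameXU, frameUU]
    -- The three components of the curvature. The first vanishes by symmetry. In the other two,
    -- `frameXX`, `frameXU`, `frameUU` are exactly what makes the coefficients of ψ_x and ψ_u
    -- cancel; what remains is ψ times `lie₂` and `lie₁` respectively.
    ext
    · simp; ring
    · simp
      linear_combination (-(v.1 * w.2 - v.2 * w.1) * y.1 / 3) * h₂
    · simp
      linear_combination (-(v.1 * w.2 - v.2 * w.1) * y.1 / 3) * h₁

/-- `ψ` solves the scalar form of the projective frame system at `z`, with zeroth-order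
coefficients `a, b, c`. -/
structure IsFrameAt (A B C D a b c : ℂ) (ψ : ℂ × ℂ → ℂ) (z : ℂ × ℂ) : Prop where
  xx : pdx (pdx ψ) z = C / 3 * pdx ψ z - D * pdu ψ z + a * ψ z
  xu : pdu (pdx ψ) z = B / 3 * pdx ψ z - C / 3 * pdu ψ z + b * ψ z
  uu : pdu (pdu ψ) z = A * pdx ψ z - B / 3 * pdu ψ z + c * ψ z

/-- The first component of the Pfaffian system identifies the other two unknowns with ψ_x and ψ_u,
so the 1-jet of ψ at the base point is arbitrary. -/
theorem exists_isFrameAt (hA : AnalyticAt ℂ A z₀) (hB : AnalyticAt ℂ B z₀)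
    (hC : AnalyticAt ℂ C z₀) (hD : AnalyticAt ℂ D z₀)
    (h₁ : ∀ᶠ z in 𝓝 z₀, lie₁ A B C D z = 0) (h₂ : ∀ᶠ z in 𝓝 z₀, lie₂ A B C D z = 0)
    (p q r : ℂ) :
    ∃ ψ : ℂ × ℂ → ℂ, AnalyticAt ℂ ψ z₀ ∧ ψ z₀ = p ∧ pdx ψ z₀ = q ∧ pdu ψ z₀ = r ∧
      ∀ᶠ z in 𝓝 z₀, IsFrameAt (A z) (B z) (C z) (D z)
        (frameXX B C D z) (frameXU A B C D z) (frameUU A B C z) ψ z := by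
  obtain ⟨Y, hY, hY0, hsol⟩ := exists_frame_solution hA hB hC hD h₁ h₂ (p, q, r)
  let coord : Fin 3 → (ℂ × ℂ × ℂ →L[ℂ] ℂ) :=
    ![ContinuousLinearMap.fst ℂ ℂ (ℂ × ℂ),
      (ContinuousLinearMap.fst ℂ ℂ ℂ).comp (ContinuousLinearMap.snd ℂ ℂ (ℂ × ℂ)),
      (ContinuousLinearMap.snd ℂ ℂ ℂ).comp (ContinuousLinearMap.snd ℂ ℂ (ℂ × ℂ))]
  have hd : ∀ᶠ z in 𝓝 z₀, ∀ i v, fderiv ℂ (fun w => coord i (Y w)) z v =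
      coord i (frameForm (A z) (B z) (C z) (D z)
        (frameXX B C D z) (frameXU A B C D z) (frameUU A B C z) v (Y z)) := by
    filter_upwards [hsol, hY.eventually_analyticAt] with z hz hYz i v
    rw [← hz]
    exact congrArg (fun L : ℂ × ℂ →L[ℂ] ℂ => L v)
      ((coord i).hasFDerivAt.comp z hYz.differentiableAt.hasFDerivAt).fderiv
  have hψx : pdx (fun w => (Y w).1) =ᶠ[𝓝 z₀] fun w => (Y w).2.1 := by
    filter_upwards [hd] with z hz
    exact (hz 0 (1, 0)).trans (by simp [coord, frameForm])
  have hψu : pdu (fun w => (Y w).1) =ᶠ[𝓝 z₀] fun w => (Y w).2.2 := by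
    filter_upwards [hd] with z hz
    exact (hz 0 (0, 1)).trans (by simp [coord, frameForm])
  refine ⟨fun w => (Y w).1, ((coord 0).analyticAt _).comp hY, by simp [hY0],
    by simp [hψx.self_of_nhds, hY0], by simp [hψu.self_of_nhds, hY0], ?_⟩
  filter_upwards [hd, hψx, hψu, hψx.pdx, hψx.pdu, hψu.pdu] with z hz e1 e2 e3 e4 e5
  refine ⟨?_, ?_, ?_⟩
  · rw [e3, e1, e2]
    exact (hz 1 (1, 0)).trans (by simp [coord, frameForm])
  · rw [e4, e1, e2]
    exact (hz 1 (0, 1)).trans (by simp [coord, frameForm])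
  · rw [e5, e1, e2]
    exact (hz 2 (0, 1)).trans (by simp [coord, frameForm])

/-- The second derivatives of `X` at `z` are the given combinations of its first derivatives. -/
structure IsAffineAt (a₁ a₂ b₁ b₂ c₁ c₂ : ℂ) (X : ℂ × ℂ → ℂ) (z : ℂ × ℂ) : Prop where
  xx : pdx (pdx X) z = a₁ * pdx X z + a₂ * pdu X z
  xu : pdu (pdx X) z = b₁ * pdx X z + b₂ * pdu X z
  uu : pdu (pdu X) z = c₁ * pdx X z + c₂ * pdu X z

/-- Infinitesimally at `z`, the coordinates `X, Y` straighten the solutions of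
`u'' = A u'³ + B u'² + C u' + D`. -/
def IsStraighteningAt (A B C D : ℂ) (X Y : ℂ × ℂ → ℂ) (z : ℂ × ℂ) : Prop :=
  ∃ b c : ℂ, IsAffineAt (C + 2 * b) (-D) ((B + c) / 2) b A c X z ∧
    IsAffineAt (C + 2 * b) (-D) ((B + c) / 2) b A c Y z

/-- The Jacobian determinant of `(X, Y)`. -/
def jac (X Y : ℂ × ℂ → ℂ) (z : ℂ × ℂ) : ℂ := pdx X z * pdu Y z - pdu X z * pdx Y z

/-- Substituting φ = Xψ into the frame equations cancels the zeroth-order terms. The symbols left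
over depend on ψ only through its logarithmic derivatives and not on φ, so quotients with a common
denominator share them, as `IsStraighteningAt` demands. -/
theorem IsFrameAt.isAffineAt_div {A B C D a b c : ℂ} {ψ φ : ℂ × ℂ → ℂ}
    (hψ : AnalyticAt ℂ ψ z) (hφ : AnalyticAt ℂ φ z) (h0 : ψ z ≠ 0)
    (h : IsFrameAt A B C D a b c ψ z) (h' : IsFrameAt A B C D a b c φ z) :
    IsAffineAt (C + 2 * (-C / 3 - pdx ψ z / ψ z)) (-D) ((B + (-B / 3 - 2 * (pdu ψ z / ψ z))) / 2)
      (-C / 3 - pdx ψ z / ψ z) A (-B / 3 - 2 * (pdu ψ z / ψ z)) (fun w => φ w / ψ w) z := by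
  have hX : AnalyticAt ℂ (fun w => φ w / ψ w) z := hφ.div hψ h0
  set X : ℂ × ℂ → ℂ := fun w => φ w / ψ w with hXdef
  have hprod : φ =ᶠ[𝓝 z] fun w => X w * ψ w := by
    filter_upwards [hψ.continuousAt.eventually_ne h0] with w hw
    simp only [hXdef]
    field_simp
  have hx : pdx φ =ᶠ[𝓝 z] fun w => X w * pdx ψ w + pdx X w * ψ w := by
    filter_upwards [hprod.pdx, hX.eventually_analyticAt, hψ.eventually_analyticAt] with w h1 h2 h3
    rw [h1, (h2.hasPartials.mul h3.hasPartials).pdx_eq]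
  have hu : pdu φ =ᶠ[𝓝 z] fun w => X w * pdu ψ w + pdu X w * ψ w := by
    filter_upwards [hprod.pdu, hX.eventually_analyticAt, hψ.eventually_analyticAt] with w h1 h2 h3
    rw [h1, (h2.hasPartials.mul h3.hasPartials).pdu_eq]
  have h1 := (hX.hasPartials.mul hψ.pdx.hasPartials).add (hX.pdx.hasPartials.mul hψ.hasPartials)
  have h2 := (hX.hasPartials.mul hψ.pdu.hasPartials).add (hX.pdu.hasPartials.mul hψ.hasPartials)
  have exx := hx.pdx.self_of_nhds.trans h1.pdx_eq
  have exu := hx.pdu.self_of_nhds.trans h1.pdu_eq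
  have euu := hu.pdu.self_of_nhds.trans h2.pdu_eq
  have e0 := hprod.self_of_nhds
  have ex := hx.self_of_nhds
  have eu := hu.self_of_nhds
  rw [h'.xx, h.xx, ex, eu, e0] at exx
  rw [h'.xu, h.xu, ex, eu, e0] at exu
  rw [h'.uu, h.uu, ex, eu, e0] at euu
  refine ⟨?_, ?_, ?_⟩
  · field_simp
    linear_combination (-3) * exx
  · field_simp
    linear_combination (-6) * exu
  · field_simp
    linear_combination (-3) * euu

/-- If the relative invariants of `u'' = A u'³ + B u'² + C u' + D` vanish near `z₀` then there are
local coordinates straightening its solutions. -/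
theorem exists_isStraighteningAt (hA : AnalyticAt ℂ A z₀) (hB : AnalyticAt ℂ B z₀)
    (hC : AnalyticAt ℂ C z₀) (hD : AnalyticAt ℂ D z₀)
    (h₁ : ∀ᶠ z in 𝓝 z₀, lie₁ A B C D z = 0) (h₂ : ∀ᶠ z in 𝓝 z₀, lie₂ A B C D z = 0) :
    ∃ X Y : ℂ × ℂ → ℂ, AnalyticAt ℂ X z₀ ∧ AnalyticAt ℂ Y z₀ ∧ jac X Y z₀ ≠ 0 ∧
      ∀ᶠ z in 𝓝 z₀, IsStraighteningAt (A z) (B z) (C z) (D z) X Y z := by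
  -- The 1-jets at the base point are the standard basis, so φ/ψ and η/ψ have Jacobian 1 there.
  obtain ⟨ψ, hψ, ψ0, ψx, ψu, hψf⟩ := exists_isFrameAt hA hB hC hD h₁ h₂ 1 0 0
  obtain ⟨φ, hφ, φ0, φx, φu, hφf⟩ := exists_isFrameAt hA hB hC hD h₁ h₂ 0 1 0
  obtain ⟨η, hη, η0, ηx, ηu, hηf⟩ := exists_isFrameAt hA hB hC hD h₁ h₂ 0 0 1
  have hne : ψ z₀ ≠ 0 := by simp [ψ0]
  have hX : AnalyticAt ℂ (fun w => φ w / ψ w) z₀ := hφ.div hψ hne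
  have hY : AnalyticAt ℂ (fun w => η w / ψ w) z₀ := hη.div hψ hne
  refine ⟨fun w => φ w / ψ w, fun w => η w / ψ w, hX, hY, ?_, ?_⟩
  · have key : ∀ {F : ℂ × ℂ → ℂ}, AnalyticAt ℂ (fun w => F w / ψ w) z₀ → F z₀ = 0 →
        pdx (fun w => F w / ψ w) z₀ = pdx F z₀ ∧ pdu (fun w => F w / ψ w) z₀ = pdu F z₀ := by
      intro F hF hF0
      have hprod : F =ᶠ[𝓝 z₀] fun w => F w / ψ w * ψ w := by
        filter_upwards [hψ.continuousAt.eventually_ne hne] with w hw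
        field_simp
      have h := hF.hasPartials.mul hψ.hasPartials
      have hx := hprod.pdx.self_of_nhds.trans h.pdx_eq
      have hu := hprod.pdu.self_of_nhds.trans h.pdu_eq
      rw [hF0, ψ0] at hx hu
      constructor
      · simpa using hx.symm
      · simpa using hu.symm
    rw [jac, (key hX φ0).1, (key hX φ0).2, (key hY η0).1, (key hY η0).2, φx, φu, ηx, ηu]
    norm_num
  · filter_upwards [hψ.eventually_analyticAt, hφ.eventually_analyticAt, hη.eventually_analyticAt,
      hψ.continuousAt.eventually_ne hne, hψf, hφf, hηf] with z h1 h2 h3 h4 h5 h6 h7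
    exact ⟨_, _, h5.isAffineAt_div h1 h2 h4 h6, h5.isAffineAt_div h1 h3 h4 h7⟩

end Frame

/-! ### Flat affine connections have vanishing invariants. -/

section Symbols

variable {a₁ a₂ b₁ b₂ c₁ c₂ X Y : ℂ × ℂ → ℂ} {z z₀ : ℂ × ℂ}

/-- Vanishing of the curvature of the affine connection with symbols `a₁, …, c₂`. -/
structure IsFlatAt (a₁ a₂ b₁ b₂ c₁ c₂ : ℂ × ℂ → ℂ) (z : ℂ × ℂ) : Prop where
  xx₁ : pdu a₁ z + a₂ z * c₁ z - pdx b₁ z - b₂ z * b₁ z = 0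
  xx₂ : pdu a₂ z + a₁ z * b₂ z + a₂ z * c₂ z - pdx b₂ z - b₁ z * a₂ z - b₂ z * b₂ z = 0
  uu₁ : pdu b₁ z + b₁ z * b₁ z + b₂ z * c₁ z - pdx c₁ z - c₁ z * a₁ z - c₂ z * b₁ z = 0
  uu₂ : pdu b₂ z + b₁ z * b₂ z - pdx c₂ z - c₁ z * a₂ z = 0

theorem eq_zero_of_jac_ne_zero (hJ : jac X Y z ≠ 0) {α β : ℂ}
    (hX : α * pdx X z + β * pdu X z = 0) (hY : α * pdx Y z + β * pdu Y z = 0) :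
    α = 0 ∧ β = 0 := by
  have h1 : jac X Y z * α = 0 := by
    rw [jac]; linear_combination pdu Y z * hX - pdu X z * hY
  have h2 : jac X Y z * β = 0 := by
    rw [jac]; linear_combination pdx X z * hY - pdx Y z * hX
  exact ⟨(mul_eq_zero.1 h1).resolve_left hJ, (mul_eq_zero.1 h2).resolve_left hJ⟩

/-- Equality of mixed third derivatives, rewritten through the affine relations, says that the
curvature annihilates the gradients of X and Y. These are independent, so the curvature is zero. -/
theorem isFlatAt_of_isAffineAt (ha₁ : AnalyticAt ℂ a₁ z) (ha₂ : AnalyticAt ℂ a₂ z)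
    (hb₁ : AnalyticAt ℂ b₁ z) (hb₂ : AnalyticAt ℂ b₂ z) (hc₁ : AnalyticAt ℂ c₁ z)
    (hc₂ : AnalyticAt ℂ c₂ z) (hX : AnalyticAt ℂ X z) (hY : AnalyticAt ℂ Y z)
    (hJ : jac X Y z ≠ 0)
    (hXa : ∀ᶠ w in 𝓝 z, IsAffineAt (a₁ w) (a₂ w) (b₁ w) (b₂ w) (c₁ w) (c₂ w) X w)
    (hYa : ∀ᶠ w in 𝓝 z, IsAffineAt (a₁ w) (a₂ w) (b₁ w) (b₂ w) (c₁ w) (c₂ w) Y w) :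
    IsFlatAt a₁ a₂ b₁ b₂ c₁ c₂ z := by
  have key : ∀ {X : ℂ × ℂ → ℂ}, AnalyticAt ℂ X z →
      (∀ᶠ w in 𝓝 z, IsAffineAt (a₁ w) (a₂ w) (b₁ w) (b₂ w) (c₁ w) (c₂ w) X w) →
      ((pdu a₁ z + a₂ z * c₁ z - pdx b₁ z - b₂ z * b₁ z) * pdx X z +
        (pdu a₂ z + a₁ z * b₂ z + a₂ z * c₂ z - pdx b₂ z - b₁ z * a₂ z - b₂ z * b₂ z) * pdu X z = 0)
      ∧ ((pdu b₁ z + b₁ z * b₁ z + b₂ z * c₁ z - pdx c₁ z - c₁ z * a₁ z - c₂ z * b₁ z) * pdx X z +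
        (pdu b₂ z + b₁ z * b₂ z - pdx c₂ z - c₁ z * a₂ z) * pdu X z = 0) := by
    intro X hX hXa
    have exx : pdx (pdx X) =ᶠ[𝓝 z] fun w => a₁ w * pdx X w + a₂ w * pdu X w :=
      hXa.mono fun w h => h.xx
    have exu : pdu (pdx X) =ᶠ[𝓝 z] fun w => b₁ w * pdx X w + b₂ w * pdu X w :=
      hXa.mono fun w h => h.xu
    have euu : pdu (pdu X) =ᶠ[𝓝 z] fun w => c₁ w * pdx X w + c₂ w * pdu X w :=
      hXa.mono fun w h => h.uu
    have hcomm : pdx (pdu X) =ᶠ[𝓝 z] pdu (pdx X) :=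
      hX.eventually_analyticAt.mono fun w h => pdx_pdu_comm h
    have pa := (ha₁.hasPartials.mul hX.pdx.hasPartials).add (ha₂.hasPartials.mul hX.pdu.hasPartials)
    have pb := (hb₁.hasPartials.mul hX.pdx.hasPartials).add (hb₂.hasPartials.mul hX.pdu.hasPartials)
    have pc := (hc₁.hasPartials.mul hX.pdx.hasPartials).add (hc₂.hasPartials.mul hX.pdu.hasPartials)
    have e1 := exx.pdu.self_of_nhds.trans pa.pdu_eq
    have e2 := exu.pdx.self_of_nhds.trans pb.pdx_eq
    have e3 := exu.pdu.self_of_nhds.trans pb.pdu_eq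
    have e4 := euu.pdx.self_of_nhds.trans pc.pdx_eq
    have e5 : pdu (pdx (pdx X)) z = pdx (pdu (pdx X)) z := (pdx_pdu_comm hX.pdx).symm
    have e6 : pdu (pdu (pdx X)) z = pdx (pdu (pdu X)) z :=
      hcomm.pdu.self_of_nhds.symm.trans (pdx_pdu_comm hX.pdu).symm
    have h := hXa.self_of_nhds
    rw [hcomm.self_of_nhds, h.xx, h.xu] at e2
    rw [h.xu, h.uu] at e1 e3
    rw [hcomm.self_of_nhds, h.xx, h.xu] at e4
    constructor
    · linear_combination e5 - e1 + e2
    · linear_combination e6 - e3 + e4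
  have kX := key hX hXa
  have kY := key hY hYa
  obtain ⟨h1, h2⟩ := eq_zero_of_jac_ne_zero hJ kX.1 kY.1
  obtain ⟨h3, h4⟩ := eq_zero_of_jac_ne_zero hJ kX.2 kY.2
  exact ⟨h1, h2, h3, h4⟩

theorem partials_eq_zero {G : ℂ × ℂ → ℂ} {d e : ℂ} (h : HasPartials G d e z)
    (hG : ∀ᶠ w in 𝓝 z, G w = 0) : d = 0 ∧ e = 0 := by
  have h0 : HasPartials (fun _ => (0 : ℂ)) d e z :=
    h.congr_of_eventuallyEq (hG.mono fun w hw => hw.symm)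
  constructor
  · rw [← h0.pdx_eq, pdx]; simp
  · rw [← h0.pdu_eq, pdu]; simp

/-- The relative invariants of the equation of unparametrised geodesics of a flat affine
connection vanish. -/
theorem lie_eq_zero_of_isFlatAt (ha₁ : AnalyticAt ℂ a₁ z) (ha₂ : AnalyticAt ℂ a₂ z)
    (hb₁ : AnalyticAt ℂ b₁ z) (hb₂ : AnalyticAt ℂ b₂ z) (hc₁ : AnalyticAt ℂ c₁ z)
    (hc₂ : AnalyticAt ℂ c₂ z) (h : ∀ᶠ w in 𝓝 z, IsFlatAt a₁ a₂ b₁ b₂ c₁ c₂ w) :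
    lie₁ c₁ (fun w => 2 * b₁ w - c₂ w) (fun w => a₁ w - 2 * b₂ w) (fun w => (-1) * a₂ w) z = 0 ∧
    lie₂ c₁ (fun w => 2 * b₁ w - c₂ w) (fun w => a₁ w - 2 * b₂ w) (fun w => (-1) * a₂ w) z = 0 := by
  have pa₁ := ha₁.hasPartials
  have pa₂ := ha₂.hasPartials
  have pb₁ := hb₁.hasPartials
  have pb₂ := hb₂.hasPartials
  have pc₁ := hc₁.hasPartials
  have pc₂ := hc₂.hasPartials
  have h0 := h.self_of_nhds
  have E1 := partials_eq_zero (((ha₁.pdu.hasPartials.add (pa₂.mul pc₁)).sub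
    hb₁.pdx.hasPartials).sub (pb₂.mul pb₁)) (h.mono fun w hw => hw.xx₁)
  have E2 := partials_eq_zero (((((ha₂.pdu.hasPartials.add (pa₁.mul pb₂)).add (pa₂.mul pc₂)).sub
    hb₂.pdx.hasPartials).sub (pb₁.mul pa₂)).sub (pb₂.mul pb₂)) (h.mono fun w hw => hw.xx₂)
  have E3 := partials_eq_zero (((((hb₁.pdu.hasPartials.add (pb₁.mul pb₁)).add (pb₂.mul pc₁)).sub
    hc₁.pdx.hasPartials).sub (pc₁.mul pa₁)).sub (pc₂.mul pb₁)) (h.mono fun w hw => hw.uu₁)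
  have E4 := partials_eq_zero (((hb₂.pdu.hasPartials.add (pb₁.mul pb₂)).sub
    hc₂.pdx.hasPartials).sub (pc₁.mul pa₂)) (h.mono fun w hw => hw.uu₂)
  have hB : ∀ᶠ w in 𝓝 z, HasPartials (fun w => 2 * b₁ w - c₂ w) (2 * pdx b₁ w - pdx c₂ w)
      (2 * pdu b₁ w - pdu c₂ w) w := by
    filter_upwards [hb₁.eventually_analyticAt, hc₂.eventually_analyticAt] with w h1 h2
    exact (h1.hasPartials.const_mul 2).sub h2.hasPartials
  have hC : ∀ᶠ w in 𝓝 z, HasPartials (fun w => a₁ w - 2 * b₂ w) (pdx a₁ w - 2 * pdx b₂ w)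
      (pdu a₁ w - 2 * pdu b₂ w) w := by
    filter_upwards [ha₁.eventually_analyticAt, hb₂.eventually_analyticAt] with w h1 h2
    exact h1.hasPartials.sub (h2.hasPartials.const_mul 2)
  have hD : ∀ᶠ w in 𝓝 z, HasPartials (fun w => (-1) * a₂ w) ((-1) * pdx a₂ w)
      ((-1) * pdu a₂ w) w := by
    filter_upwards [ha₂.eventually_analyticAt] with w h1
    exact h1.hasPartials.const_mul (-1)
  have hBx : pdx (fun w => 2 * b₁ w - c₂ w) =ᶠ[𝓝 z] fun w => 2 * pdx b₁ w - pdx c₂ w :=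
    hB.mono fun w h => h.pdx_eq
  have hCx : pdx (fun w => a₁ w - 2 * b₂ w) =ᶠ[𝓝 z] fun w => pdx a₁ w - 2 * pdx b₂ w :=
    hC.mono fun w h => h.pdx_eq
  have hCu : pdu (fun w => a₁ w - 2 * b₂ w) =ᶠ[𝓝 z] fun w => pdu a₁ w - 2 * pdu b₂ w :=
    hC.mono fun w h => h.pdu_eq
  have hDu : pdu (fun w => (-1) * a₂ w) =ᶠ[𝓝 z] fun w => (-1) * pdu a₂ w :=
    hD.mono fun w h => h.pdu_eq
  have qBx := (hb₁.pdx.hasPartials.const_mul 2).sub hc₂.pdx.hasPartials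
  have qCx := ha₁.pdx.hasPartials.sub (hb₂.pdx.hasPartials.const_mul 2)
  have qCu := ha₁.pdu.hasPartials.sub (hb₂.pdu.hasPartials.const_mul 2)
  have qDu := ha₂.pdu.hasPartials.const_mul (-1)
  simp only [lie₁, lie₂]
  rw [hBx.pdu.self_of_nhds, hCu.pdu.self_of_nhds, hBx.pdx.self_of_nhds, hCx.pdu.self_of_nhds,
    hDu.pdu.self_of_nhds, qBx.pdu_eq, qCu.pdu_eq, qBx.pdx_eq, qCx.pdu_eq, qDu.pdu_eq,
    hB.self_of_nhds.pdx_eq, hB.self_of_nhds.pdu_eq, hC.self_of_nhds.pdx_eq,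
    hC.self_of_nhds.pdu_eq, hD.self_of_nhds.pdx_eq, hD.self_of_nhds.pdu_eq]
  obtain ⟨E1x, E1u⟩ := E1
  obtain ⟨E2x, E2u⟩ := E2
  obtain ⟨E3x, E3u⟩ := E3
  obtain ⟨E4x, E4u⟩ := E4
  rw [pdx_pdu_comm ha₁] at E1x
  rw [pdx_pdu_comm hb₁] at E3x
  rw [pdx_pdu_comm hb₂] at E4x
  -- Each invariant is a combination of the curvature components and their first derivatives.
  constructor
  · linear_combination E1u - 3 * E3x - 2 * E4u + (2 * b₁ z - c₂ z) * h0.xx₁ + 3 * c₁ z * h0.xx₂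
      + 3 * b₂ z * h0.uu₁ + (2 * c₂ z - b₁ z) * h0.uu₂
  · linear_combination -3 * E2u - 2 * E1x + E4x + 3 * a₂ z * h0.uu₁ + 3 * b₁ z * h0.xx₂
      + (2 * a₁ z - b₂ z) * h0.xx₁ + (2 * b₂ z - a₁ z) * h0.uu₂

theorem _root_.AnalyticAt.jac (hX : AnalyticAt ℂ X z) (hY : AnalyticAt ℂ Y z) :
    AnalyticAt ℂ (jac X Y) z :=
  (hX.pdx.mul hY.pdu).sub (hX.pdu.mul hY.pdx)

/-- Any pair of local coordinates straightens the solutions of some equation cubic in `u'` with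
vanishing relative invariants. -/
theorem exists_straightened_equation (hX : AnalyticAt ℂ X z₀) (hY : AnalyticAt ℂ Y z₀)
    (hJ : jac X Y z₀ ≠ 0) :
    ∃ A B C D : ℂ × ℂ → ℂ, AnalyticAt ℂ A z₀ ∧ AnalyticAt ℂ B z₀ ∧ AnalyticAt ℂ C z₀ ∧
      AnalyticAt ℂ D z₀ ∧ lie₁ A B C D z₀ = 0 ∧ lie₂ A B C D z₀ = 0 ∧
      ∀ᶠ z in 𝓝 z₀, IsStraighteningAt (A z) (B z) (C z) (D z) X Y z := by
  -- Cramer's rule: `s₁`, `s₂` are the coefficients of (P, Q) in the basis (X_x, Y_x), (X_u, Y_u).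
  let s₁ : (ℂ × ℂ → ℂ) → (ℂ × ℂ → ℂ) → ℂ × ℂ → ℂ := fun P Q z =>
    (P z * pdu Y z - Q z * pdu X z) / jac X Y z
  let s₂ : (ℂ × ℂ → ℂ) → (ℂ × ℂ → ℂ) → ℂ × ℂ → ℂ := fun P Q z =>
    (pdx X z * Q z - pdx Y z * P z) / jac X Y z
  have hs₁ : ∀ {P Q}, AnalyticAt ℂ P z₀ → AnalyticAt ℂ Q z₀ → AnalyticAt ℂ (s₁ P Q) z₀ :=
    fun hP hQ => ((hP.mul hY.pdu).sub (hQ.mul hX.pdu)).div (hX.jac hY) hJ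
  have hs₂ : ∀ {P Q}, AnalyticAt ℂ P z₀ → AnalyticAt ℂ Q z₀ → AnalyticAt ℂ (s₂ P Q) z₀ :=
    fun hP hQ => ((hX.pdx.mul hQ).sub (hY.pdx.mul hP)).div (hX.jac hY) hJ
  have hsolX : ∀ (P Q : ℂ × ℂ → ℂ) (z : ℂ × ℂ), jac X Y z ≠ 0 →
      P z = s₁ P Q z * pdx X z + s₂ P Q z * pdu X z := by
    intro P Q z hz
    simp only [s₁, s₂]
    field_simp
    rw [jac]; ring
  have hsolY : ∀ (P Q : ℂ × ℂ → ℂ) (z : ℂ × ℂ), jac X Y z ≠ 0 →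
      Q z = s₁ P Q z * pdx Y z + s₂ P Q z * pdu Y z := by
    intro P Q z hz
    simp only [s₁, s₂]
    field_simp
    rw [jac]; ring
  have hne : ∀ᶠ z in 𝓝 z₀, jac X Y z ≠ 0 := (hX.jac hY).continuousAt.eventually_ne hJ
  let a₁ := s₁ (pdx (pdx X)) (pdx (pdx Y))
  let a₂ := s₂ (pdx (pdx X)) (pdx (pdx Y))
  let b₁ := s₁ (pdu (pdx X)) (pdu (pdx Y))
  let b₂ := s₂ (pdu (pdx X)) (pdu (pdx Y))
  let c₁ := s₁ (pdu (pdu X)) (pdu (pdu Y))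
  let c₂ := s₂ (pdu (pdu X)) (pdu (pdu Y))
  have ha₁ : AnalyticAt ℂ a₁ z₀ := hs₁ hX.pdx.pdx hY.pdx.pdx
  have ha₂ : AnalyticAt ℂ a₂ z₀ := hs₂ hX.pdx.pdx hY.pdx.pdx
  have hb₁ : AnalyticAt ℂ b₁ z₀ := hs₁ hX.pdx.pdu hY.pdx.pdu
  have hb₂ : AnalyticAt ℂ b₂ z₀ := hs₂ hX.pdx.pdu hY.pdx.pdu
  have hc₁ : AnalyticAt ℂ c₁ z₀ := hs₁ hX.pdu.pdu hY.pdu.pdu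
  have hc₂ : AnalyticAt ℂ c₂ z₀ := hs₂ hX.pdu.pdu hY.pdu.pdu
  have hXa : ∀ᶠ w in 𝓝 z₀, IsAffineAt (a₁ w) (a₂ w) (b₁ w) (b₂ w) (c₁ w) (c₂ w) X w :=
    hne.mono fun w hw => ⟨hsolX _ _ w hw, hsolX _ _ w hw, hsolX _ _ w hw⟩
  have hYa : ∀ᶠ w in 𝓝 z₀, IsAffineAt (a₁ w) (a₂ w) (b₁ w) (b₂ w) (c₁ w) (c₂ w) Y w :=
    hne.mono fun w hw => ⟨hsolY _ _ w hw, hsolY _ _ w hw, hsolY _ _ w hw⟩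
  have hflat : ∀ᶠ w in 𝓝 z₀, IsFlatAt a₁ a₂ b₁ b₂ c₁ c₂ w := by
    filter_upwards [ha₁.eventually_analyticAt, ha₂.eventually_analyticAt,
      hb₁.eventually_analyticAt, hb₂.eventually_analyticAt, hc₁.eventually_analyticAt,
      hc₂.eventually_analyticAt, hX.eventually_analyticAt, hY.eventually_analyticAt, hne,
      hXa.eventually_nhds, hYa.eventually_nhds] with w h1 h2 h3 h4 h5 h6 h7 h8 h9 h10 h11
    exact isFlatAt_of_isAffineAt h1 h2 h3 h4 h5 h6 h7 h8 h9 h10 h11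
  obtain ⟨hl₁, hl₂⟩ := lie_eq_zero_of_isFlatAt ha₁ ha₂ hb₁ hb₂ hc₁ hc₂ hflat
  -- The coefficients come from inverting the relations a₁ = C + 2b, a₂ = -D, b₁ = (B + c)/2, b₂ =
  -- b, c₁ = A, c₂ = c of `IsStraighteningAt`.
  refine ⟨c₁, fun w => 2 * b₁ w - c₂ w, fun w => a₁ w - 2 * b₂ w, fun w => (-1) * a₂ w, hc₁, (analyticAt_const.mul hb₁).sub hc₂,
    ha₁.sub (analyticAt_const.mul hb₂), analyticAt_const.mul ha₂, hl₁, hl₂, ?_⟩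
  filter_upwards [hXa, hYa] with w h1 h2
  refine ⟨b₂ w, c₂ w, ?_, ?_⟩
  · convert h1 using 1 <;> ring
  · convert h2 using 1 <;> ring

end Symbols

/-! ### Two-jets of analytic functions along curves. -/

section Curves

/-- `y` is differentiable near `t`, with first and second derivatives `d, e` at `t`. -/
structure HasTwoJet (y : ℝ → ℂ) (d e : ℂ) (t : ℝ) : Prop where
  eventually_differentiableAt : ∀ᶠ s in 𝓝 t, DifferentiableAt ℝ y s
  deriv_eq : deriv y t = d
  hasDerivAt_deriv : HasDerivAt (deriv y) e t

variable {ξ η : ℝ → ℂ} {ξ₁ ξ₂ η₁ η₂ : ℂ} {t : ℝ}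

theorem hasDerivAt_comp_curve {Ψ : ℂ × ℂ → ℂ} (hΨ : DifferentiableAt ℂ Ψ (ξ t, η t))
    (hξ : HasDerivAt ξ ξ₁ t) (hη : HasDerivAt η η₁ t) :
    HasDerivAt (fun s => Ψ (ξ s, η s)) (ξ₁ * pdx Ψ (ξ t, η t) + η₁ * pdu Ψ (ξ t, η t)) t := by
  have h := (hΨ.hasFDerivAt.restrictScalars ℝ).comp_hasDerivAt t (hξ.prodMk hη)
  refine h.congr_deriv ?_
  exact fderiv_apply_eq Ψ _ (ξ₁, η₁)

theorem HasTwoJet.hasDerivAt {y : ℝ → ℂ} {d e : ℂ} (h : HasTwoJet y d e t) : HasDerivAt y d t :=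
  h.deriv_eq ▸ h.eventually_differentiableAt.self_of_nhds.hasDerivAt

/-- First derivative of `Ψ` along a curve through `z` with velocity `(ξ₁, η₁)`. -/
def jet₁ (Ψ : ℂ × ℂ → ℂ) (z : ℂ × ℂ) (ξ₁ η₁ : ℂ) : ℂ := ξ₁ * pdx Ψ z + η₁ * pdu Ψ z

/-- Second derivative of `Ψ` along a curve through `z` with velocity `(ξ₁, η₁)` and acceleration
`(ξ₂, η₂)`. -/
def jet₂ (Ψ : ℂ × ℂ → ℂ) (z : ℂ × ℂ) (ξ₁ η₁ ξ₂ η₂ : ℂ) : ℂ :=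
  ξ₂ * pdx Ψ z + η₂ * pdu Ψ z + ξ₁ ^ 2 * pdx (pdx Ψ) z + 2 * ξ₁ * η₁ * pdu (pdx Ψ) z
    + η₁ ^ 2 * pdu (pdu Ψ) z

theorem HasTwoJet.unique {y : ℝ → ℂ} {d e d' e' : ℂ} (h : HasTwoJet y d e t)
    (h' : HasTwoJet y d' e' t) : d = d' ∧ e = e' :=
  ⟨h.deriv_eq.symm.trans h'.deriv_eq, h.hasDerivAt_deriv.unique h'.hasDerivAt_deriv⟩

/-- The two-jet of an analytic function along a curve. -/
theorem HasTwoJet.comp {Ψ : ℂ × ℂ → ℂ} (hξ : HasTwoJet ξ ξ₁ ξ₂ t) (hη : HasTwoJet η η₁ η₂ t)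
    (hΨ : AnalyticAt ℂ Ψ (ξ t, η t)) :
    HasTwoJet (fun s => Ψ (ξ s, η s)) (jet₁ Ψ (ξ t, η t) ξ₁ η₁)
      (jet₂ Ψ (ξ t, η t) ξ₁ η₁ ξ₂ η₂) t := by
  have hcont : Tendsto (fun s => (ξ s, η s)) (𝓝 t) (𝓝 (ξ t, η t)) :=
    (hξ.hasDerivAt.continuousAt.prodMk hη.hasDerivAt.continuousAt)
  have hev : ∀ᶠ s in 𝓝 t, HasDerivAt (fun s => Ψ (ξ s, η s))
      (deriv ξ s * pdx Ψ (ξ s, η s) + deriv η s * pdu Ψ (ξ s, η s)) s := by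
    filter_upwards [hcont.eventually hΨ.eventually_analyticAt, hξ.eventually_differentiableAt,
      hη.eventually_differentiableAt] with s h1 h2 h3
    exact hasDerivAt_comp_curve h1.differentiableAt h2.hasDerivAt h3.hasDerivAt
  refine ⟨hev.mono fun s hs => hs.differentiableAt, ?_, ?_⟩
  · rw [hev.self_of_nhds.deriv, hξ.deriv_eq, hη.deriv_eq, jet₁]
  · have hx := hasDerivAt_comp_curve hΨ.pdx.differentiableAt hξ.hasDerivAt hη.hasDerivAt
    have hu := hasDerivAt_comp_curve hΨ.pdu.differentiableAt hξ.hasDerivAt hη.hasDerivAt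
    have h := (hξ.hasDerivAt_deriv.mul hx).add (hη.hasDerivAt_deriv.mul hu)
    have heq : deriv (fun s => Ψ (ξ s, η s)) =ᶠ[𝓝 t] fun s =>
        deriv ξ s * pdx Ψ (ξ s, η s) + deriv η s * pdu Ψ (ξ s, η s) :=
      hev.mono fun s hs => hs.deriv
    refine (h.congr_of_eventuallyEq heq).congr_deriv ?_
    rw [hξ.deriv_eq, hη.deriv_eq, pdx_pdu_comm hΨ, jet₂]
    ring

/-- Along a curve, the acceleration in straightening coordinates measures the defect of the
equation `u'' = A u'³ + B u'² + C u' + D`. -/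
theorem IsStraighteningAt.wronskian_eq {A B C D : ℂ} {X Y : ℂ × ℂ → ℂ} {z : ℂ × ℂ}
    (h : IsStraighteningAt A B C D X Y z) (ξ₁ ξ₂ η₁ η₂ : ℂ) :
    jet₂ Y z ξ₁ η₁ ξ₂ η₂ * jet₁ X z ξ₁ η₁ - jet₁ Y z ξ₁ η₁ * jet₂ X z ξ₁ η₁ ξ₂ η₂
      = jac X Y z * (ξ₁ * η₂ - η₁ * ξ₂
        - (A * η₁ ^ 3 + B * η₁ ^ 2 * ξ₁ + C * η₁ * ξ₁ ^ 2 + D * ξ₁ ^ 3)) := by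
  -- The free parameters b and c contribute to the second derivatives of X and Y the same multiple
  -- 2bξ₁ + cη₁ of the first derivatives, which drops out of the Wronskian.
  obtain ⟨b, c, hX, hY⟩ := h
  simp only [jet₁, jet₂]
  rw [hX.xx, hX.xu, hX.uu, hY.xx, hY.xu, hY.uu, jac]
  ring

theorem HasTwoJet.derivWrt_eq {X Y : ℝ → ℂ} {p₁ p₂ q₁ q₂ : ℂ} (hX : HasTwoJet X p₁ p₂ t)
    (hY : HasTwoJet Y q₁ q₂ t) : derivWrt X Y t = q₁ / p₁ := by
  rw [derivWrt, hX.deriv_eq, hY.deriv_eq]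

theorem HasTwoJet.derivWrt_derivWrt_eq {X Y : ℝ → ℂ} {p₁ p₂ q₁ q₂ : ℂ}
    (hX : HasTwoJet X p₁ p₂ t) (hY : HasTwoJet Y q₁ q₂ t) (hp : p₁ ≠ 0) :
    derivWrt X (derivWrt X Y) t = (q₂ * p₁ - q₁ * p₂) / p₁ ^ 3 := by
  have hne : deriv X t ≠ 0 := by rwa [hX.deriv_eq]
  have h : HasDerivAt (derivWrt X Y) _ t := hY.hasDerivAt_deriv.div hX.hasDerivAt_deriv hne
  rw [derivWrt, h.deriv, hX.deriv_eq, hY.deriv_eq]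
  field_simp

end Curves

/-! ### Real and imaginary parts: from the four conditions to the invariants. -/

section Splitting

/-- Near `p`, the functions `F₁, F₂` are the real and imaginary parts of the analytic function
`F`. -/
structure SplitsAt (F : ℂ × ℂ → ℂ) (F₁ F₂ : ℝ → ℝ → ℝ → ℝ) (p : ℝ × ℝ × ℝ) : Prop where
  analyticAt : AnalyticAt ℂ F (toComplex p)
  eventually_eq : ∀ᶠ q in 𝓝 p, F (toComplex q) =
      (F₁ q.1 q.2.1 q.2.2 : ℂ) + (F₂ q.1 q.2.1 q.2.2 : ℂ) * Complex.I

theorem continuous_toComplex : Continuous toComplex := by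
  unfold toComplex; fun_prop

variable {F : ℂ × ℂ → ℂ} {F₁ F₂ : ℝ → ℝ → ℝ → ℝ} {p : ℝ × ℝ × ℝ}

theorem SplitsAt.eventually (h : SplitsAt F F₁ F₂ p) : ∀ᶠ q in 𝓝 p, SplitsAt F F₁ F₂ q := by
  filter_upwards [continuous_toComplex.continuousAt.eventually h.analyticAt.eventually_analyticAt,
    h.eventually_eq.eventually_nhds] with q h1 h2
  exact ⟨h1, h2⟩

theorem re_im_of_hasDerivAt {y : ℝ → ℂ} {y₁ y₂ : ℝ → ℝ} {d : ℂ} {t : ℝ} (h : HasDerivAt y d t)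
    (heq : ∀ᶠ s in 𝓝 t, y s = (y₁ s : ℂ) + (y₂ s : ℂ) * Complex.I) :
    d = ((deriv y₁ t : ℝ) : ℂ) + ((deriv y₂ t : ℝ) : ℂ) * Complex.I := by
  have h1 : HasDerivAt y₁ d.re t := by
    have := Complex.reCLM.hasFDerivAt.comp_hasDerivAt t h
    refine HasDerivAt.congr_of_eventuallyEq this (heq.mono fun s hs => ?_)
    simp [hs]
  have h2 : HasDerivAt y₂ d.im t := by
    have := Complex.imCLM.hasFDerivAt.comp_hasDerivAt t h
    refine HasDerivAt.congr_of_eventuallyEq this (heq.mono fun s hs => ?_)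
    simp [hs]
  rw [h1.deriv, h2.deriv, Complex.re_add_im]

/-- The chain rule along the three coordinate lines, whose images in ℂ² have velocities (1, 0), (0,
1) and (0, i). -/
theorem SplitsAt.partials (h : SplitsAt F F₁ F₂ p) :
    pdx F (toComplex p) = (dx F₁ p.1 p.2.1 p.2.2 : ℂ) + (dx F₂ p.1 p.2.1 p.2.2 : ℂ) * Complex.I ∧
    pdu F (toComplex p) = (df F₁ p.1 p.2.1 p.2.2 : ℂ) + (df F₂ p.1 p.2.1 p.2.2 : ℂ) * Complex.I ∧
    Complex.I * pdu F (toComplex p) =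
      (dg F₁ p.1 p.2.1 p.2.2 : ℂ) + (dg F₂ p.1 p.2.1 p.2.2 : ℂ) * Complex.I := by
  obtain ⟨x, f, g⟩ := p
  have hd := h.analyticAt.differentiableAt
  have hx : HasDerivAt (fun s : ℝ => (s : ℂ)) 1 x := Complex.ofRealCLM.hasDerivAt
  have hf : HasDerivAt (fun s : ℝ => (s : ℂ) + (g : ℂ) * Complex.I) 1 f :=
    (Complex.ofRealCLM.hasDerivAt (x := f)).add_const _
  have hg : HasDerivAt (fun s : ℝ => (f : ℂ) + (s : ℂ) * Complex.I) Complex.I g := by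
    simpa using ((Complex.ofRealCLM.hasDerivAt (x := g)).mul_const Complex.I).const_add (f : ℂ)
  have cx : Tendsto (fun s : ℝ => (s, f, g)) (𝓝 x) (𝓝 (x, f, g)) :=
    Continuous.tendsto (by fun_prop) x
  have cf : Tendsto (fun s : ℝ => (x, s, g)) (𝓝 f) (𝓝 (x, f, g)) :=
    Continuous.tendsto (by fun_prop) f
  have cg : Tendsto (fun s : ℝ => (x, f, s)) (𝓝 g) (𝓝 (x, f, g)) :=
    Continuous.tendsto (by fun_prop) g
  have e1 := hasDerivAt_comp_curve (ξ := fun s : ℝ => (s : ℂ))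
    (η := fun _ => (f : ℂ) + (g : ℂ) * Complex.I) (t := x) hd hx (hasDerivAt_const _ _)
  have e2 := hasDerivAt_comp_curve (ξ := fun _ : ℝ => (x : ℂ))
    (η := fun s : ℝ => (s : ℂ) + (g : ℂ) * Complex.I) (t := f) hd (hasDerivAt_const _ _) hf
  have e3 := hasDerivAt_comp_curve (ξ := fun _ : ℝ => (x : ℂ))
    (η := fun s : ℝ => (f : ℂ) + (s : ℂ) * Complex.I) (t := g) hd (hasDerivAt_const _ _) hg
  have r1 := re_im_of_hasDerivAt e1 (cx.eventually h.eventually_eq)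
  have r2 := re_im_of_hasDerivAt e2 (cf.eventually h.eventually_eq)
  have r3 := re_im_of_hasDerivAt e3 (cg.eventually h.eventually_eq)
  simp only [one_mul, zero_mul, add_zero, zero_add] at r1 r2 r3
  exact ⟨r1, r2, r3⟩

theorem SplitsAt.dx (h : SplitsAt F F₁ F₂ p) : SplitsAt (pdx F) (dx F₁) (dx F₂) p :=
  ⟨h.analyticAt.pdx, h.eventually.mono fun _ hq => hq.partials.1⟩

theorem SplitsAt.df (h : SplitsAt F F₁ F₂ p) : SplitsAt (pdu F) (df F₁) (df F₂) p :=
  ⟨h.analyticAt.pdu, h.eventually.mono fun _ hq => hq.partials.2.1⟩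

theorem SplitsAt.dg (h : SplitsAt F F₁ F₂ p) :
    SplitsAt (fun z => Complex.I * pdu F z) (dg F₁) (dg F₂) p :=
  ⟨analyticAt_const.mul h.analyticAt.pdu, h.eventually.mono fun _ hq => hq.partials.2.2⟩

end Splitting

section Splitting

variable {F : ℂ × ℂ → ℂ} {F₁ F₂ : ℝ → ℝ → ℝ → ℝ} {x f g : ℝ}

/-- With `SplitsAt.laplace`, this trades every g-derivative in the conditions for f-derivatives,
which are the real and imaginary parts of u-derivatives. -/
theorem SplitsAt.cauchyRiemann (h : SplitsAt F F₁ F₂ (x, f, g)) :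
    CplxLin.dg F₁ x f g = - CplxLin.df F₂ x f g ∧ CplxLin.dg F₂ x f g = CplxLin.df F₁ x f g := by
  obtain ⟨-, h2, h3⟩ := h.partials
  rw [h2] at h3
  have hre := congrArg Complex.re h3
  have him := congrArg Complex.im h3
  simp at hre him
  exact ⟨hre.symm, him.symm⟩

theorem SplitsAt.laplace (h : SplitsAt F F₁ F₂ (x, f, g)) :
    CplxLin.dg (CplxLin.dg F₁) x f g = - CplxLin.df (CplxLin.df F₁) x f g ∧
      CplxLin.dg (CplxLin.dg F₂) x f g = - CplxLin.df (CplxLin.df F₂) x f g := by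
  have h3 := h.dg.partials.2.2
  have h2 := h.df.partials.2.1
  rw [(h.analyticAt.pdu.hasPartials.const_mul Complex.I).pdu_eq, h2] at h3
  have hre := congrArg Complex.re h3
  have him := congrArg Complex.im h3
  simp at hre him
  exact ⟨hre.symm, him.symm⟩

theorem SplitsAt.apply_eq (h : SplitsAt F F₁ F₂ (x, f, g)) :
    F (toComplex (x, f, g)) = (F₁ x f g : ℂ) + (F₂ x f g : ℂ) * Complex.I :=
  h.eventually_eq.self_of_nhds

variable {S : Coeffs} {A B C D : ℂ × ℂ → ℂ}

/-- The first pair of conditions is the vanishing of the first relative invariant. -/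
theorem cond_eq_lie₁ (hA : SplitsAt A S.A₁ S.A₂ (x, f, g)) (hB : SplitsAt B S.B₁ S.B₂ (x, f, g))
    (hC : SplitsAt C S.C₁ S.C₂ (x, f, g)) (hD : SplitsAt D S.D₁ S.D₂ (x, f, g)) :
    (S.cond₁ x f g : ℂ) + (S.cond₂ x f g : ℂ) * Complex.I =
      4 * lie₁ A B C D (toComplex (x, f, g)) := by
  -- The factor 4 arises because a pair such as A¹_f + A²_g is twice Re A_u, and C¹_ff - C¹_gg +
  -- 2C²_fg is four times Re C_uu.
  simp only [Coeffs.cond₁, Coeffs.cond₂, Pi.add_apply, Pi.sub_apply, Pi.mul_apply,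
    Pi.ofNat_apply, lie₁, hA.apply_eq, hB.apply_eq, hC.apply_eq, hD.apply_eq, hA.dx.apply_eq,
    hB.dx.apply_eq, hC.dx.apply_eq, hA.df.apply_eq, hC.df.apply_eq, hD.df.apply_eq,
    hA.dx.dx.apply_eq, hC.df.df.apply_eq, hB.dx.df.apply_eq, hA.cauchyRiemann.1,
    hA.cauchyRiemann.2, hC.cauchyRiemann.1, hC.cauchyRiemann.2, hD.cauchyRiemann.1,
    hD.cauchyRiemann.2, hC.df.cauchyRiemann.1, hC.df.cauchyRiemann.2, hB.dx.cauchyRiemann.1,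
    hB.dx.cauchyRiemann.2, hC.laplace.1, hC.laplace.2]
  apply Complex.ext <;> simp <;> ring

/-- The second pair of conditions is the vanishing of the second relative invariant. -/
theorem cond_eq_lie₂ (hA : SplitsAt A S.A₁ S.A₂ (x, f, g)) (hB : SplitsAt B S.B₁ S.B₂ (x, f, g))
    (hC : SplitsAt C S.C₁ S.C₂ (x, f, g)) (hD : SplitsAt D S.D₁ S.D₂ (x, f, g)) :
    (S.cond₃ x f g : ℂ) + (S.cond₄ x f g : ℂ) * Complex.I =
      4 * lie₂ A B C D (toComplex (x, f, g)) := by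
  simp only [Coeffs.cond₃, Coeffs.cond₄, Pi.add_apply, Pi.sub_apply, Pi.mul_apply,
    Pi.ofNat_apply, lie₂, hA.apply_eq, hB.apply_eq, hC.apply_eq, hD.apply_eq, hA.dx.apply_eq,
    hB.dx.apply_eq, hD.dx.apply_eq, hB.df.apply_eq, hC.df.apply_eq, hD.df.apply_eq,
    hB.dx.dx.apply_eq, hD.df.df.apply_eq, hC.dx.df.apply_eq, hB.cauchyRiemann.1,
    hB.cauchyRiemann.2, hC.cauchyRiemann.1, hC.cauchyRiemann.2, hD.cauchyRiemann.1,
    hD.cauchyRiemann.2, hD.df.cauchyRiemann.1, hD.df.cauchyRiemann.2, hC.dx.cauchyRiemann.1,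
    hC.dx.cauchyRiemann.2, hD.laplace.1, hD.laplace.2]
  apply Complex.ext <;> simp <;> ring

theorem add_mul_I_eq_zero_iff (a b : ℝ) :
    (a : ℂ) + (b : ℂ) * Complex.I = 0 ↔ a = 0 ∧ b = 0 := by
  simp [Complex.ext_iff]

theorem cond_iff_lie (hA : SplitsAt A S.A₁ S.A₂ (x, f, g)) (hB : SplitsAt B S.B₁ S.B₂ (x, f, g))
    (hC : SplitsAt C S.C₁ S.C₂ (x, f, g)) (hD : SplitsAt D S.D₁ S.D₂ (x, f, g)) :
    (S.cond₁ x f g = 0 ∧ S.cond₂ x f g = 0 ∧ S.cond₃ x f g = 0 ∧ S.cond₄ x f g = 0) ↔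
      lie₁ A B C D (toComplex (x, f, g)) = 0 ∧ lie₂ A B C D (toComplex (x, f, g)) = 0 := by
  have h1 := cond_eq_lie₁ hA hB hC hD
  have h2 := cond_eq_lie₂ hA hB hC hD
  rw [← and_assoc, ← add_mul_I_eq_zero_iff, ← add_mul_I_eq_zero_iff, h1, h2]
  simp

/-- An analytic function of `(x, u)` vanishing for real `x` vanishes. -/
theorem eventually_eq_zero_of_real {K : ℂ × ℂ → ℂ} {p : ℝ × ℝ × ℝ}
    (hK : AnalyticAt ℂ K (toComplex p)) (h : ∀ᶠ q in 𝓝 p, K (toComplex q) = 0) :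
    ∀ᶠ z in 𝓝 (toComplex p), K z = 0 := by
  obtain ⟨δ, hδ, hball⟩ := Metric.eventually_nhds_iff_ball.1 hK.eventually_analyticAt
  obtain ⟨ε, hε, hzero⟩ := Metric.eventually_nhds_iff_ball.1 h
  have hr : 0 < min δ ε := lt_min hδ hε
  filter_upwards [Metric.ball_mem_nhds (toComplex p) hr] with z hz
  obtain ⟨x, u⟩ := z
  rw [← ball_prod_same, mem_prod] at hz
  obtain ⟨hx, hu⟩ := hz
  -- For fixed u, already an arbitrary complex number, K is analytic in x on a disc and vanishes on
  -- the real points near its centre; the one-variable identity theorem applies.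
  have hana : AnalyticOnNhd ℂ (fun ζ => K (ζ, u)) (Metric.ball ((p.1 : ℝ) : ℂ) (min δ ε)) := by
    intro ζ hζ
    refine AnalyticAt.comp (f := fun ζ : ℂ => (ζ, u)) (hball (ζ, u) ?_)
      (analyticAt_id.prod analyticAt_const)
    rw [← ball_prod_same, mem_prod]
    exact ⟨Metric.ball_subset_ball (min_le_left _ _) hζ,
      Metric.ball_subset_ball (min_le_left _ _) hu⟩
  have hreal : ∀ᶠ s : ℝ in 𝓝[≠] p.1, K ((s : ℂ), u) = 0 := by
    refine eventually_nhdsWithin_of_eventually_nhds ?_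
    filter_upwards [Metric.ball_mem_nhds p.1 hε] with s hs
    have := hzero (s, u.re, u.im) ?_
    · simpa [toComplex] using this
    · have hu' : ‖u - ((p.2.1 : ℂ) + (p.2.2 : ℂ) * Complex.I)‖ < ε := by
        rw [← dist_eq_norm]
        exact lt_of_lt_of_le hu (min_le_right _ _)
      have h1 : |u.re - p.2.1| < ε := by
        refine lt_of_le_of_lt ?_ hu'
        simpa using Complex.abs_re_le_norm (u - ((p.2.1 : ℂ) + (p.2.2 : ℂ) * Complex.I))
      have h2 : |u.im - p.2.2| < ε := by
        refine lt_of_le_of_lt ?_ hu'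
        simpa using Complex.abs_im_le_norm (u - ((p.2.1 : ℂ) + (p.2.2 : ℂ) * Complex.I))
      rw [Metric.mem_ball, Prod.dist_eq, Prod.dist_eq]
      exact max_lt hs (max_lt h1 h2)
  have htend : Tendsto (fun s : ℝ => (s : ℂ)) (𝓝[≠] p.1) (𝓝[≠] ((p.1 : ℝ) : ℂ)) :=
    Complex.continuous_ofReal.continuousAt.tendsto.inf
      (tendsto_principal_principal.2 fun s hs => by simpa using hs)
  have hfreq : ∃ᶠ ζ in 𝓝[≠] ((p.1 : ℝ) : ℂ), K (ζ, u) = 0 :=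
    htend.frequently hreal.frequently
  exact hana.eqOn_zero_of_preconnected_of_frequently_eq_zero
    (convex_ball _ _).isPreconnected (Metric.mem_ball_self hr) hfreq hx

theorem analyticAt_lie₁ {z : ℂ × ℂ} (hA : AnalyticAt ℂ A z) (hB : AnalyticAt ℂ B z)
    (hC : AnalyticAt ℂ C z) (hD : AnalyticAt ℂ D z) : AnalyticAt ℂ (lie₁ A B C D) z := by
  have := hA.pdx
  have := hA.pdu
  have := hA.pdx.pdx
  have := hB.pdx
  have := hB.pdx.pdu
  have := hC.pdx
  have := hC.pdu
  have := hC.pdu.pdu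
  have := hD.pdu
  unfold lie₁
  fun_prop

theorem analyticAt_lie₂ {z : ℂ × ℂ} (hA : AnalyticAt ℂ A z) (hB : AnalyticAt ℂ B z)
    (hC : AnalyticAt ℂ C z) (hD : AnalyticAt ℂ D z) : AnalyticAt ℂ (lie₂ A B C D) z := by
  have := hA.pdx
  have := hB.pdx
  have := hB.pdu
  have := hB.pdx.pdx
  have := hC.pdu
  have := hC.pdx.pdu
  have := hD.pdx
  have := hD.pdu
  have := hD.pdu.pdu
  unfold lie₂
  fun_prop

end Splitting

/-! ### The real system as one complex equation, and sufficiency. -/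

section System

variable {S : Coeffs} {A B C D : ℂ × ℂ → ℂ} {p : ℝ × ℝ × ℝ} {f g : ℝ → ℝ} {J : Set ℝ} {t : ℝ}

/-- Near `p` the coefficients of the system come from the analytic functions `A, B, C, D`. -/
structure Coeffs.SplitsAt (S : Coeffs) (A B C D : ℂ × ℂ → ℂ) (p : ℝ × ℝ × ℝ) : Prop where
  A : CplxLin.SplitsAt A S.A₁ S.A₂ p
  B : CplxLin.SplitsAt B S.B₁ S.B₂ p
  C : CplxLin.SplitsAt C S.C₁ S.C₂ p
  D : CplxLin.SplitsAt D S.D₁ S.D₂ p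

theorem Coeffs.SplitsAt.eventually (h : S.SplitsAt A B C D p) :
    ∀ᶠ q in 𝓝 p, S.SplitsAt A B C D q := by
  filter_upwards [h.A.eventually, h.B.eventually, h.C.eventually, h.D.eventually]
    with q h1 h2 h3 h4
  exact ⟨h1, h2, h3, h4⟩

/-- The system is the complex equation `u'' = A u'³ + B u'² + C u' + D`. -/
theorem Coeffs.SplitsAt.rhs_eq {x y₁ y₂ : ℝ} (h : S.SplitsAt A B C D (x, y₁, y₂)) (m₁ m₂ : ℝ) :
    (S.rhs₁ x y₁ y₂ m₁ m₂ : ℂ) + (S.rhs₂ x y₁ y₂ m₁ m₂ : ℂ) * Complex.I =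
      A (toComplex (x, y₁, y₂)) * ((m₁ : ℂ) + m₂ * Complex.I) ^ 3
      + B (toComplex (x, y₁, y₂)) * ((m₁ : ℂ) + m₂ * Complex.I) ^ 2
      + C (toComplex (x, y₁, y₂)) * ((m₁ : ℂ) + m₂ * Complex.I)
      + D (toComplex (x, y₁, y₂)) := by
  rw [h.A.apply_eq, h.B.apply_eq, h.C.apply_eq, h.D.apply_eq]
  simp only [Coeffs.rhs₁, Coeffs.rhs₂]
  apply Complex.ext <;> simp [pow_succ] <;> ring

theorem add_mul_I_inj {a b c d : ℝ} :
    (a : ℂ) + (b : ℂ) * Complex.I = (c : ℂ) + (d : ℂ) * Complex.I ↔ a = c ∧ b = d := by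
  simp [Complex.ext_iff]

theorem hasTwoJet_ofReal (t : ℝ) : HasTwoJet (fun s : ℝ => (s : ℂ)) 1 0 t := by
  have h : ∀ s : ℝ, HasDerivAt (fun s : ℝ => (s : ℂ)) 1 s := fun s =>
    Complex.ofRealCLM.hasDerivAt
  refine ⟨Eventually.of_forall fun s => (h s).differentiableAt, (h t).deriv, ?_⟩
  have : deriv (fun s : ℝ => (s : ℂ)) = fun _ => 1 := funext fun s => (h s).deriv
  rw [this]
  exact hasDerivAt_const t 1

theorem hasTwoJet_pair (hJ : IsOpen J) (hf : TwiceDiffOn f J) (hg : TwiceDiffOn g J)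
    (ht : t ∈ J) :
    HasTwoJet (fun s => (f s : ℂ) + (g s : ℂ) * Complex.I)
      (((deriv f t : ℝ) : ℂ) + ((deriv g t : ℝ) : ℂ) * Complex.I)
      (((deriv (deriv f) t : ℝ) : ℂ) + ((deriv (deriv g) t : ℝ) : ℂ) * Complex.I) t := by
  have h : ∀ s ∈ J, HasDerivAt (fun s => (f s : ℂ) + (g s : ℂ) * Complex.I)
      (((deriv f s : ℝ) : ℂ) + ((deriv g s : ℝ) : ℂ) * Complex.I) s := fun s hs =>
    (hf s hs).1.hasDerivAt.ofReal_comp.add ((hg s hs).1.hasDerivAt.ofReal_comp.mul_const Complex.I)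
  have hev := hJ.mem_nhds ht
  refine ⟨?_, (h t ht).deriv, ?_⟩
  · filter_upwards [hev] with s hs
    exact (h s hs).differentiableAt
  · have h2 := (hf t ht).2.hasDerivAt.ofReal_comp.add
      ((hg t ht).2.hasDerivAt.ofReal_comp.mul_const Complex.I)
    refine h2.congr_of_eventuallyEq ?_
    filter_upwards [hev] with s hs
    exact (h s hs).deriv

theorem hasTwoJet_along {Ψ : ℂ × ℂ → ℂ} (hJ : IsOpen J) (hf : TwiceDiffOn f J)
    (hg : TwiceDiffOn g J) (ht : t ∈ J) (hΨ : AnalyticAt ℂ Ψ (toComplex (t, f t, g t))) :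
    HasTwoJet (along Ψ f g)
      (jet₁ Ψ (toComplex (t, f t, g t)) 1
        (((deriv f t : ℝ) : ℂ) + ((deriv g t : ℝ) : ℂ) * Complex.I))
      (jet₂ Ψ (toComplex (t, f t, g t)) 1
        (((deriv f t : ℝ) : ℂ) + ((deriv g t : ℝ) : ℂ) * Complex.I) 0
        (((deriv (deriv f) t : ℝ) : ℂ) + ((deriv (deriv g) t : ℝ) : ℂ) * Complex.I)) t :=
  (hasTwoJet_ofReal t).comp (hasTwoJet_pair hJ hf hg ht) hΨ

/-- If the conditions hold near `p`, the system is carried near `p` into `d²U/dχ² = 0`. -/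
theorem exists_linearizesAt (hS : S.SplitsAt A B C D p)
    (h₁ : ∀ᶠ z in 𝓝 (toComplex p), lie₁ A B C D z = 0)
    (h₂ : ∀ᶠ z in 𝓝 (toComplex p), lie₂ A B C D z = 0) :
    ∃ χ U : ℂ × ℂ → ℂ, LinearizesAt S.rhs₁ S.rhs₂ p χ U 0 0 0 := by
  obtain ⟨X, Y, hX, hY, hJ, hstr⟩ := exists_isStraighteningAt hS.A.analyticAt hS.B.analyticAt
    hS.C.analyticAt hS.D.analyticAt h₁ h₂
  refine ⟨X, Y, hX, hY, hJ, analyticAt_const, analyticAt_const, analyticAt_const, ?_⟩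
  have hc : Tendsto toComplex (𝓝 p) (𝓝 (toComplex p)) := continuous_toComplex.tendsto p
  have hW : ∀ᶠ q in 𝓝 p, S.SplitsAt A B C D q ∧ AnalyticAt ℂ X (toComplex q) ∧
      AnalyticAt ℂ Y (toComplex q) ∧ jac X Y (toComplex q) ≠ 0 ∧
      IsStraighteningAt (A (toComplex q)) (B (toComplex q)) (C (toComplex q)) (D (toComplex q))
        X Y (toComplex q) := by
    filter_upwards [hS.eventually, hc.eventually hX.eventually_analyticAt,
      hc.eventually hY.eventually_analyticAt,
      hc.eventually ((hX.jac hY).continuousAt.eventually_ne hJ), hc.eventually hstr]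
      with q h1 h2 h3 h4 h5
    exact ⟨h1, h2, h3, h4, h5⟩
  refine ⟨_, hW, ?_⟩
  intro a b f g hf hg hgraph hχ
  have key : ∀ t ∈ Ioo a b,
      (deriv (deriv f) t = S.rhs₁ t (f t) (g t) (deriv f t) (deriv g t) ∧
        deriv (deriv g) t = S.rhs₂ t (f t) (g t) (deriv f t) (deriv g t)) ↔
      derivWrt (along X f g) (derivWrt (along X f g) (along Y f g)) t =
        (0 : ℂ → ℂ) (along X f g t) * derivWrt (along X f g) (along Y f g) t
          + (0 : ℂ → ℂ) (along X f g t) * along Y f g t + (0 : ℂ → ℂ) (along X f g t) := by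
    intro t ht
    obtain ⟨hs, hXt, hYt, hJt, hst⟩ := hgraph t ht
    have jX := hasTwoJet_along isOpen_Ioo hf hg ht hXt
    have jY := hasTwoJet_along isOpen_Ioo hf hg ht hYt
    have hne := hχ t ht
    rw [jX.deriv_eq] at hne
    rw [jX.derivWrt_derivWrt_eq jY hne, ← add_mul_I_inj, hs.rhs_eq]
    simp only [Pi.zero_apply, zero_mul, add_zero]
    rw [div_eq_zero_iff, or_iff_left (pow_ne_zero 3 hne)]
    -- The curve is parametrised by x itself: velocity 1 and acceleration 0 in the first coordinate.
    -- The Wronskian, the numerator of d²Y/dX², is then the Jacobian times the defect of the complex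
    -- equation.
    have hw := hst.wronskian_eq 1 0
      (((deriv f t : ℝ) : ℂ) + ((deriv g t : ℝ) : ℂ) * Complex.I)
      (((deriv (deriv f) t : ℝ) : ℂ) + ((deriv (deriv g) t : ℝ) : ℂ) * Complex.I)
    refine Iff.trans ?_ (Eq.congr_left hw.symm)
    rw [mul_eq_zero, or_iff_right hJt, ← sub_eq_zero]
    refine Eq.congr_left ?_
    ring
  constructor
  · rintro ⟨-, -, h⟩ t ht
    exact (key t ht).1 (h t ht)
  · intro h
    exact ⟨hf, hg, fun t ht => (key t ht).2 (h t ht)⟩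

end System

/-! ### Local solutions of the initial value problem. -/

section Existence

variable {S : Coeffs} {A B C D : ℂ × ℂ → ℂ}

/-- The system has a local solution with prescribed initial values. -/
theorem exists_isSolutionOn {x₀ f₀ g₀ : ℝ} (hS : S.SplitsAt A B C D (x₀, f₀, g₀)) (m₁ m₂ : ℝ) :
    ∃ f g : ℝ → ℝ, ∃ ε > 0, IsSolutionOn S.rhs₁ S.rhs₂ f g (Ioo (x₀ - ε) (x₀ + ε)) ∧
      f x₀ = f₀ ∧ g x₀ = g₀ ∧ deriv f x₀ = m₁ ∧ deriv g x₀ = m₂ := by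
  let z₀ : ℂ × ℂ := toComplex (x₀, f₀, g₀)
  let m : ℂ := (m₁ : ℂ) + m₂ * Complex.I
  let w : ℂ × ℂ × ℂ → ℂ := fun y => A (y.1, y.2.1) * y.2.2 ^ 3 + B (y.1, y.2.1) * y.2.2 ^ 2
    + C (y.1, y.2.1) * y.2.2 + D (y.1, y.2.1)
  -- An autonomous field in (x, u, u'), integrated in real time by Picard–Lindelöf.
  let V : ℂ × ℂ × ℂ → ℂ × ℂ × ℂ := fun y => (1, y.2.2, w y)
  have hpair : AnalyticAt ℂ (fun y : ℂ × ℂ × ℂ => (y.1, y.2.1)) (z₀.1, z₀.2, m) :=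
    analyticAt_fst.prod (analyticAt_fst.comp analyticAt_snd)
  have hcoef : ∀ {F : ℂ × ℂ → ℂ}, AnalyticAt ℂ F z₀ →
      AnalyticAt ℂ (fun y : ℂ × ℂ × ℂ => F (y.1, y.2.1)) (z₀.1, z₀.2, m) :=
    fun hF => AnalyticAt.comp (f := fun y : ℂ × ℂ × ℂ => (y.1, y.2.1)) hF hpair
  have hV : AnalyticAt ℂ V (z₀.1, z₀.2, m) := by
    have h1 := hcoef hS.A.analyticAt
    have h2 := hcoef hS.B.analyticAt
    have h3 := hcoef hS.C.analyticAt
    have h4 := hcoef hS.D.analyticAt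
    have h5 : AnalyticAt ℂ (fun y : ℂ × ℂ × ℂ => y.2.2) (z₀.1, z₀.2, m) :=
      analyticAt_snd.comp analyticAt_snd
    have hw : AnalyticAt ℂ w (z₀.1, z₀.2, m) :=
      (((h1.mul (h5.pow 3)).add (h2.mul (h5.pow 2))).add (h3.mul h5)).add h4
    exact analyticAt_const.prod (h5.prod hw)
  have hV' : ContDiffAt ℝ 1 V (z₀.1, z₀.2, m) := hV.contDiffAt.restrict_scalars ℝ
  obtain ⟨α, hα0, ε, hε, hα⟩ :=
    hV'.exists_forall_mem_closedBall_exists_eq_forall_mem_Ioo_hasDerivAt₀ x₀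
  have hx₀ : x₀ ∈ Ioo (x₀ - ε) (x₀ + ε) := ⟨by linarith, by linarith⟩
  have h1 : ∀ t ∈ Ioo (x₀ - ε) (x₀ + ε), HasDerivAt (fun s => (α s).1) 1 t := fun t ht =>
    (ContinuousLinearMap.fst ℝ ℂ (ℂ × ℂ)).hasFDerivAt.comp_hasDerivAt t (hα t ht)
  have h23 : ∀ t ∈ Ioo (x₀ - ε) (x₀ + ε), HasDerivAt (fun s => (α s).2) ((α t).2.2, w (α t)) t :=
    fun t ht => (ContinuousLinearMap.snd ℝ ℂ (ℂ × ℂ)).hasFDerivAt.comp_hasDerivAt t (hα t ht)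
  have h2 : ∀ t ∈ Ioo (x₀ - ε) (x₀ + ε), HasDerivAt (fun s => (α s).2.1) (α t).2.2 t :=
    fun t ht => (ContinuousLinearMap.fst ℝ ℂ ℂ).hasFDerivAt.comp_hasDerivAt t (h23 t ht)
  have h3 : ∀ t ∈ Ioo (x₀ - ε) (x₀ + ε), HasDerivAt (fun s => (α s).2.2) (w (α t)) t :=
    fun t ht => (ContinuousLinearMap.snd ℝ ℂ ℂ).hasFDerivAt.comp_hasDerivAt t (h23 t ht)
  -- The first coordinate is complex a priori; it must be the real time for the solution to lie over
  -- real points, where the coefficients split.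
  have hα1 : ∀ t ∈ Ioo (x₀ - ε) (x₀ + ε), (α t).1 = (t : ℂ) := by
    have hd : ∀ t ∈ Ioo (x₀ - ε) (x₀ + ε), HasDerivAt (fun s => (α s).1 - (s : ℂ)) 0 t := by
      intro t ht
      have := (h1 t ht).sub (Complex.ofRealCLM.hasDerivAt (x := t))
      exact this.congr_deriv (by simp)
    intro t ht
    have := isOpen_Ioo.is_const_of_deriv_eq_zero isPreconnected_Ioo
      (fun s hs => (hd s hs).differentiableAt.differentiableWithinAt)
      (fun s hs => (hd s hs).deriv) ht hx₀
    rw [hα0] at this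
    simpa [z₀, toComplex, sub_eq_zero] using this
  let f : ℝ → ℝ := fun s => (α s).2.1.re
  let g : ℝ → ℝ := fun s => (α s).2.1.im
  have hf : ∀ t ∈ Ioo (x₀ - ε) (x₀ + ε), HasDerivAt f (α t).2.2.re t := fun t ht =>
    Complex.reCLM.hasFDerivAt.comp_hasDerivAt t (h2 t ht)
  have hg : ∀ t ∈ Ioo (x₀ - ε) (x₀ + ε), HasDerivAt g (α t).2.2.im t := fun t ht =>
    Complex.imCLM.hasFDerivAt.comp_hasDerivAt t (h2 t ht)
  have hf' : ∀ t ∈ Ioo (x₀ - ε) (x₀ + ε), HasDerivAt (deriv f) (w (α t)).re t := by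
    intro t ht
    refine HasDerivAt.congr_of_eventuallyEq
      (Complex.reCLM.hasFDerivAt.comp_hasDerivAt t (h3 t ht)) ?_
    filter_upwards [isOpen_Ioo.mem_nhds ht] with s hs
    exact (hf s hs).deriv
  have hg' : ∀ t ∈ Ioo (x₀ - ε) (x₀ + ε), HasDerivAt (deriv g) (w (α t)).im t := by
    intro t ht
    refine HasDerivAt.congr_of_eventuallyEq
      (Complex.imCLM.hasFDerivAt.comp_hasDerivAt t (h3 t ht)) ?_
    filter_upwards [isOpen_Ioo.mem_nhds ht] with s hs
    exact (hg s hs).deriv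
  have hf0 : f x₀ = f₀ := by simp [f, hα0, z₀, toComplex]
  have hg0 : g x₀ = g₀ := by simp [g, hα0, z₀, toComplex]
  have hcont : Tendsto (fun s => (s, f s, g s)) (𝓝 x₀) (𝓝 (x₀, f₀, g₀)) := by
    have : ContinuousAt (fun s => (s, f s, g s)) x₀ :=
      continuousAt_id.prodMk ((hf x₀ hx₀).continuousAt.prodMk (hg x₀ hx₀).continuousAt)
    simpa [ContinuousAt, hf0, hg0] using this
  obtain ⟨δ, hδ, hball⟩ := Metric.eventually_nhds_iff_ball.1 (hcont.eventually hS.eventually)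
  have hsub : Ioo (x₀ - min ε δ) (x₀ + min ε δ) ⊆ Ioo (x₀ - ε) (x₀ + ε) :=
    Ioo_subset_Ioo (by linarith [min_le_left ε δ]) (by linarith [min_le_left ε δ])
  refine ⟨f, g, min ε δ, lt_min hε hδ, ⟨?_, ?_, ?_⟩, hf0, hg0, ?_, ?_⟩
  · exact fun t ht => ⟨(hf t (hsub ht)).differentiableAt, (hf' t (hsub ht)).differentiableAt⟩
  · exact fun t ht => ⟨(hg t (hsub ht)).differentiableAt, (hg' t (hsub ht)).differentiableAt⟩
  · intro t ht
    have htδ : t ∈ Metric.ball x₀ δ := by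
      rw [Real.ball_eq_Ioo]
      exact Ioo_subset_Ioo (by linarith [min_le_right ε δ]) (by linarith [min_le_right ε δ]) ht
    rw [← add_mul_I_inj, (hball t htδ).rhs_eq, (hf' t (hsub ht)).deriv, (hg' t (hsub ht)).deriv,
      (hf t (hsub ht)).deriv, (hg t (hsub ht)).deriv, Complex.re_add_im, Complex.re_add_im]
    have hz : toComplex (t, f t, g t) = ((α t).1, (α t).2.1) := by
      simp only [toComplex, f, g, Complex.re_add_im]
      rw [hα1 t (hsub ht)]
    rw [hz]
  · rw [(hf x₀ hx₀).deriv, hα0]; simp [m]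
  · rw [(hg x₀ hx₀).deriv, hα0]; simp [m]

end Existence

/-- Multiplying by α + mβ removes the excluded slope: the product is a polynomial of degree at most
four vanishing for all m. Its values at 0, ±1, ±2 yield its five coefficients, and a nonzero α or β
can then be divided out. -/
theorem cubic_coeffs_eq_zero {α β a b c d : ℂ} (hαβ : α ≠ 0 ∨ β ≠ 0)
    (h : ∀ m : ℂ, α + m * β ≠ 0 → a * m ^ 3 + b * m ^ 2 + c * m + d = 0) :
    a = 0 ∧ b = 0 ∧ c = 0 ∧ d = 0 := by
  have h' : ∀ m : ℂ, (α + m * β) * (a * m ^ 3 + b * m ^ 2 + c * m + d) = 0 := by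
    intro m
    by_cases hm : α + m * β = 0
    · rw [hm, zero_mul]
    · rw [h m hm, mul_zero]
  have e0 := h' 0
  have e1 := h' 1
  have e2 := h' (-1)
  have e3 := h' 2
  have e4 := h' (-2)
  have q0 : α * d = 0 := by linear_combination e0
  have q4 : β * a = 0 := by
    linear_combination (1 / 4) * e0 - (1 / 6) * e1 - (1 / 6) * e2 + (1 / 24) * e3 + (1 / 24) * e4
  have q2 : α * b + β * c = 0 := by
    linear_combination (-5 / 4) * e0 + (2 / 3) * e1 + (2 / 3) * e2 - (1 / 24) * e3 - (1 / 24) * e4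
  have q1 : α * c + β * d = 0 := by
    linear_combination (2 / 3) * e1 - (2 / 3) * e2 - (1 / 12) * e3 + (1 / 12) * e4
  have q3 : α * a + β * b = 0 := by
    linear_combination (-1 / 6) * e1 + (1 / 6) * e2 + (1 / 12) * e3 - (1 / 12) * e4
  by_cases hβ : β = 0
  · subst hβ
    have hα : α ≠ 0 := by simpa using hαβ
    simp [hα] at q0 q1 q2 q3
    exact ⟨q3, q2, q1, q0⟩
  · have ha : a = 0 := by simpa [hβ] using q4
    have hb : b = 0 := by simpa [hβ, ha] using q3
    have hc : c = 0 := by simpa [hβ, hb] using q2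
    have hd : d = 0 := by simpa [hβ, hc] using q1
    exact ⟨ha, hb, hc, hd⟩

/-! ### Invariants of linear equations, and change of coordinates. -/

section Linear

variable {P Q R : ℂ → ℂ} {z₀ : ℂ × ℂ}

theorem hasPartials_comp_fst {P : ℂ → ℂ} {z : ℂ × ℂ} (hP : DifferentiableAt ℂ P z.1) :
    HasPartials (fun w => P w.1) (deriv P z.1) 0 z := by
  refine (HasFDerivAt.congr_fderiv
    (HasDerivAt.comp_hasFDerivAt z hP.hasDerivAt hasFDerivAt_fst) ?_)
  ext <;> simp

theorem hasPartials_snd (z : ℂ × ℂ) : HasPartials (fun w => w.2) 0 1 z := by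
  refine HasFDerivAt.congr_fderiv hasFDerivAt_snd ?_
  ext <;> simp

theorem pdx_zero (z : ℂ × ℂ) : pdx (fun _ => 0) z = 0 := by simp [pdx]

theorem pdu_zero (z : ℂ × ℂ) : pdu (fun _ => 0) z = 0 := by simp [pdu]

/-- The relative invariants of a linear equation vanish. -/
theorem lie_eq_zero_of_linear (hP : AnalyticAt ℂ P z₀.1) (hQ : AnalyticAt ℂ Q z₀.1)
    (hR : AnalyticAt ℂ R z₀.1) :
    lie₁ (fun _ => 0) (fun _ => 0) (fun z => P z.1) (fun z => Q z.1 * z.2 + R z.1) z₀ = 0 ∧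
    lie₂ (fun _ => 0) (fun _ => 0) (fun z => P z.1) (fun z => Q z.1 * z.2 + R z.1) z₀ = 0 := by
  have hfst : Tendsto (fun z : ℂ × ℂ => z.1) (𝓝 z₀) (𝓝 z₀.1) := continuous_fst.tendsto z₀
  have hPx : pdx (fun z => P z.1) =ᶠ[𝓝 z₀] fun z => deriv P z.1 := by
    filter_upwards [hfst.eventually hP.eventually_analyticAt] with z hz
    exact (hasPartials_comp_fst hz.differentiableAt).pdx_eq
  have hPu : pdu (fun z => P z.1) =ᶠ[𝓝 z₀] fun _ => 0 := by
    filter_upwards [hfst.eventually hP.eventually_analyticAt] with z hz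
    exact (hasPartials_comp_fst hz.differentiableAt).pdu_eq
  have hDu : pdu (fun z => Q z.1 * z.2 + R z.1) =ᶠ[𝓝 z₀] fun z => Q z.1 := by
    filter_upwards [hfst.eventually hQ.eventually_analyticAt,
      hfst.eventually hR.eventually_analyticAt] with z hz hz'
    rw [(((hasPartials_comp_fst hz.differentiableAt).mul (hasPartials_snd z)).add
      (hasPartials_comp_fst hz'.differentiableAt)).pdu_eq]
    ring
  have e1 : pdu (pdx fun z => P z.1) z₀ = 0 :=
    hPx.pdu.self_of_nhds.trans (hasPartials_comp_fst hP.deriv.differentiableAt).pdu_eq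
  have e2 : pdu (pdu fun z => P z.1) z₀ = 0 := hPu.pdu.self_of_nhds.trans (pdu_zero z₀)
  have e3 : pdu (pdu fun z => Q z.1 * z.2 + R z.1) z₀ = 0 :=
    hDu.pdu.self_of_nhds.trans (hasPartials_comp_fst hQ.differentiableAt).pdu_eq
  have hx0 : pdx (fun _ => (0 : ℂ)) = fun _ => 0 := funext pdx_zero
  have hu0 : pdu (fun _ => (0 : ℂ)) = fun _ => 0 := funext pdu_zero
  simp only [lie₁, lie₂, hx0, hu0, e1, e2, e3, hPu.self_of_nhds]
  constructor <;> ring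

end Linear

theorem jac_comp {X Y χ U : ℂ × ℂ → ℂ} {z : ℂ × ℂ} (hX : DifferentiableAt ℂ X (χ z, U z))
    (hY : DifferentiableAt ℂ Y (χ z, U z)) (hχ : DifferentiableAt ℂ χ z)
    (hU : DifferentiableAt ℂ U z) :
    jac (fun w => X (χ w, U w)) (fun w => Y (χ w, U w)) z = jac X Y (χ z, U z) * jac χ U z := by
  have key : ∀ {X : ℂ × ℂ → ℂ}, DifferentiableAt ℂ X (χ z, U z) → ∀ v,
      fderiv ℂ (fun w => X (χ w, U w)) z v =
        fderiv ℂ χ z v * pdx X (χ z, U z) + fderiv ℂ U z v * pdu X (χ z, U z) := by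
    intro X hX v
    have h := (hX.hasFDerivAt.comp z (hχ.hasFDerivAt.prodMk hU.hasFDerivAt)).fderiv
    have h' := congrArg (fun L : ℂ × ℂ →L[ℂ] ℂ => L v) h
    refine h'.trans ?_
    exact fderiv_apply_eq X _ (fderiv ℂ χ z v, fderiv ℂ U z v)
  have hx : ∀ {X : ℂ × ℂ → ℂ}, DifferentiableAt ℂ X (χ z, U z) →
      pdx (fun w => X (χ w, U w)) z =
        pdx χ z * pdx X (χ z, U z) + pdx U z * pdu X (χ z, U z) := fun hX => key hX _
  have hu : ∀ {X : ℂ × ℂ → ℂ}, DifferentiableAt ℂ X (χ z, U z) →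
      pdu (fun w => X (χ w, U w)) z =
        pdu χ z * pdx X (χ z, U z) + pdu U z * pdu X (χ z, U z) := fun hX => key hX _
  simp only [jac, hx hX, hx hY, hu hX, hu hY]
  ring

/-! ### Linearizable systems satisfy the conditions. -/

section Necessity

variable {S : Coeffs} {A B C D χ U X Y : ℂ × ℂ → ℂ} {P Q R : ℂ → ℂ}

/-- If the solutions of the system through a point become solutions of a linear equation, and
`X, Y` straighten the latter, then the system agrees at that point with the equation straightened
by the composite coordinates. -/
theorem cubic_eq_of_maps_solutions {x₀ f₀ g₀ : ℝ} {W : Set (ℝ × ℝ × ℝ)} {z : ℂ × ℂ}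
    (hz : z = toComplex (x₀, f₀, g₀)) (hW : W ∈ 𝓝 (x₀, f₀, g₀))
    (hS : S.SplitsAt A B C D (x₀, f₀, g₀))
    (hmaps : ∀ (a b : ℝ) (f g : ℝ → ℝ),
      TwiceDiffOn f (Ioo a b) → TwiceDiffOn g (Ioo a b) →
      (∀ x ∈ Ioo a b, (x, f x, g x) ∈ W) →
      (∀ x ∈ Ioo a b, deriv (along χ f g) x ≠ 0) →
      IsSolutionOn S.rhs₁ S.rhs₂ f g (Ioo a b) →
        ∀ x ∈ Ioo a b,
          derivWrt (along χ f g) (derivWrt (along χ f g) (along U f g)) x =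
            P (along χ f g x) * derivWrt (along χ f g) (along U f g) x
              + Q (along χ f g x) * along U f g x + R (along χ f g x))
    (hχ : AnalyticAt ℂ χ z) (hU : AnalyticAt ℂ U z) (hX : AnalyticAt ℂ X (χ z, U z))
    (hY : AnalyticAt ℂ Y (χ z, U z))
    (hstr : IsStraighteningAt 0 0 (P (χ z)) (Q (χ z) * U z + R (χ z)) X Y (χ z, U z))
    {A' B' C' D' : ℂ}
    (hstr' : IsStraighteningAt A' B' C' D' (fun w => X (χ w, U w)) (fun w => Y (χ w, U w)) z)
    (hJ' : jac (fun w => X (χ w, U w)) (fun w => Y (χ w, U w)) z ≠ 0)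
    {m : ℂ} (hm : pdx χ z + m * pdu χ z ≠ 0) :
    A z * m ^ 3 + B z * m ^ 2 + C z * m + D z = A' * m ^ 3 + B' * m ^ 2 + C' * m + D' := by
  -- A solution through the given point with the prescribed complex slope m turns the statement
  -- about solutions into one about coefficients.
  obtain ⟨f, g, ε, hε, hsol, hf0, hg0, hf1, hg1⟩ := exists_isSolutionOn hS m.re m.im
  have hx₀ : x₀ ∈ Ioo (x₀ - ε) (x₀ + ε) := ⟨by linarith, by linarith⟩
  have hzt : toComplex (x₀, f x₀, g x₀) = z := by rw [hf0, hg0, hz]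
  have hmv : ((deriv f x₀ : ℝ) : ℂ) + ((deriv g x₀ : ℝ) : ℂ) * Complex.I = m := by
    rw [hf1, hg1, Complex.re_add_im]
  set n : ℂ := ((deriv (deriv f) x₀ : ℝ) : ℂ) + ((deriv (deriv g) x₀ : ℝ) : ℂ) * Complex.I with hn
  have jet : ∀ {Ψ : ℂ × ℂ → ℂ}, AnalyticAt ℂ Ψ z →
      HasTwoJet (along Ψ f g) (jet₁ Ψ z 1 m) (jet₂ Ψ z 1 m 0 n) x₀ := by
    intro Ψ hΨ
    have := hasTwoJet_along isOpen_Ioo hsol.1 hsol.2.1 hx₀ (hzt.symm ▸ hΨ)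
    rwa [hmv, hzt, ← hn] at this
  have jχ := jet hχ
  have jU := jet hU
  have hp : jet₁ χ z 1 m ≠ 0 := by rwa [jet₁, one_mul]
  have hcont : Tendsto (fun s => (s, f s, g s)) (𝓝 x₀) (𝓝 (x₀, f₀, g₀)) := by
    have : ContinuousAt (fun s => (s, f s, g s)) x₀ :=
      continuousAt_id.prodMk ((hsol.1 x₀ hx₀).1.continuousAt.prodMk
        (hsol.2.1 x₀ hx₀).1.continuousAt)
    simpa [ContinuousAt, hf0, hg0] using this
  have hdne : ∀ᶠ s in 𝓝 x₀, deriv (along χ f g) s ≠ 0 :=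
    jχ.hasDerivAt_deriv.continuousAt.eventually_ne (by rwa [jχ.deriv_eq])
  obtain ⟨δ, hδ, hball⟩ := Metric.eventually_nhds_iff_ball.1
    ((hcont.eventually hW).and (hdne.and (isOpen_Ioo.eventually_mem hx₀)))
  rw [Real.ball_eq_Ioo] at hball
  have hxδ : x₀ ∈ Ioo (x₀ - δ) (x₀ + δ) := ⟨by linarith, by linarith⟩
  have heq := hmaps (x₀ - δ) (x₀ + δ) f g (fun s hs => hsol.1 s (hball s hs).2.2)
    (fun s hs => hsol.2.1 s (hball s hs).2.2) (fun s hs => (hball s hs).1)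
    (fun s hs => (hball s hs).2.1)
    ⟨fun s hs => hsol.1 s (hball s hs).2.2, fun s hs => hsol.2.1 s (hball s hs).2.2,
      fun s hs => hsol.2.2 s (hball s hs).2.2⟩ x₀ hxδ
  have haχ : along χ f g x₀ = χ z := by rw [along, hzt]
  have haU : along U f g x₀ = U z := by rw [along, hzt]
  rw [jχ.derivWrt_derivWrt_eq jU hp, jχ.derivWrt_eq jU, haχ, haU] at heq
  -- The linear equation cleared of denominators, as a cubic equation with A = B = 0, C = P and D =
  -- QU + R: the form occurring in `wronskian_eq`.
  have hlin : jet₁ χ z 1 m * jet₂ U z 1 m 0 n - jet₁ U z 1 m * jet₂ χ z 1 m 0 n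
      - (0 * jet₁ U z 1 m ^ 3 + 0 * jet₁ U z 1 m ^ 2 * jet₁ χ z 1 m
        + P (χ z) * jet₁ U z 1 m * jet₁ χ z 1 m ^ 2
        + (Q (χ z) * U z + R (χ z)) * jet₁ χ z 1 m ^ 3) = 0 := by
    field_simp at heq
    linear_combination heq
  have hX' : AnalyticAt ℂ X (along χ f g x₀, along U f g x₀) := by rwa [haχ, haU]
  have hY' : AnalyticAt ℂ Y (along χ f g x₀, along U f g x₀) := by rwa [haχ, haU]
  have jX := jχ.comp jU hX'
  have jY := jχ.comp jU hY'
  rw [haχ, haU] at jX jY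
  have hpair : AnalyticAt ℂ (fun w => (χ w, U w)) z := hχ.prod hU
  have jX' := jet (Ψ := fun w => X (χ w, U w))
    (AnalyticAt.comp (f := fun w => (χ w, U w)) hX hpair)
  have jY' := jet (Ψ := fun w => Y (χ w, U w))
    (AnalyticAt.comp (f := fun w => (χ w, U w)) hY hpair)
  -- The jets of X(χ, U) and Y(χ, U) are computed along (χ, U) and along (x, u). The first Wronskian
  -- is zero by `hlin`, so the second is too, and its nonzero Jacobian factor can be cancelled.
  obtain ⟨uX₁, uX₂⟩ := jX.unique jX'
  obtain ⟨uY₁, uY₂⟩ := jY.unique jY'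
  have w1 := hstr.wronskian_eq (jet₁ χ z 1 m) (jet₂ χ z 1 m 0 n) (jet₁ U z 1 m)
    (jet₂ U z 1 m 0 n)
  have w2 := hstr'.wronskian_eq 1 0 m n
  rw [hlin, mul_zero, uX₁, uX₂, uY₁, uY₂, w2] at w1
  have hn' : n = A z * m ^ 3 + B z * m ^ 2 + C z * m + D z := by
    have h := hsol.2.2 x₀ hx₀
    rw [hf0, hg0, ← add_mul_I_inj, hS.rhs_eq, hmv, ← hz] at h
    exact h
  have := (mul_eq_zero.1 w1).resolve_left hJ'
  rw [hn'] at this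
  linear_combination this

/-- The witnesses are the coefficients of the equation straightened by the composite coordinates.
Agreement with A, B, C, D is needed only at real points, since these already determine the real
coefficients and hence the four conditions. -/
theorem LinearizesAt.exists_splitsAt {p : ℝ × ℝ × ℝ} (hS : S.SplitsAt A B C D p)
    (h : LinearizesAt S.rhs₁ S.rhs₂ p χ U P Q R) :
    ∃ A' B' C' D' : ℂ × ℂ → ℂ, S.SplitsAt A' B' C' D' p ∧
      lie₁ A' B' C' D' (toComplex p) = 0 ∧ lie₂ A' B' C' D' (toComplex p) = 0 := by
  set z₀ := toComplex p with hz₀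
  have hχ := h.analytic_χ
  have hU := h.analytic_U
  have hJ : jac χ U z₀ ≠ 0 := h.jacobian_ne_zero
  have hfst : Tendsto (fun z : ℂ × ℂ => z.1) (𝓝 (χ z₀, U z₀)) (𝓝 (χ z₀)) :=
    continuous_fst.tendsto _
  have hlie : ∀ᶠ z in 𝓝 (χ z₀, U z₀),
      lie₁ (fun _ => 0) (fun _ => 0) (fun z => P z.1) (fun z => Q z.1 * z.2 + R z.1) z = 0 ∧
      lie₂ (fun _ => 0) (fun _ => 0) (fun z => P z.1) (fun z => Q z.1 * z.2 + R z.1) z = 0 := by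
    filter_upwards [hfst.eventually h.analytic_P.eventually_analyticAt,
      hfst.eventually h.analytic_Q.eventually_analyticAt,
      hfst.eventually h.analytic_R.eventually_analyticAt] with z h1 h2 h3
    exact lie_eq_zero_of_linear h1 h2 h3
  have cfst : ∀ {P : ℂ → ℂ}, AnalyticAt ℂ P (χ z₀) →
      AnalyticAt ℂ (fun z : ℂ × ℂ => P z.1) (χ z₀, U z₀) :=
    fun hP => AnalyticAt.comp (f := fun z : ℂ × ℂ => z.1) hP analyticAt_fst
  obtain ⟨X, Y, hX, hY, hJXY, hstr⟩ := exists_isStraighteningAt analyticAt_const analyticAt_const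
    (cfst h.analytic_P)
    (((cfst h.analytic_Q).mul analyticAt_snd).add (cfst h.analytic_R) :
      AnalyticAt ℂ (fun z : ℂ × ℂ => Q z.1 * z.2 + R z.1) (χ z₀, U z₀))
    (hlie.mono fun _ h => h.1) (hlie.mono fun _ h => h.2)
  have hpair : AnalyticAt ℂ (fun w => (χ w, U w)) z₀ := hχ.prod hU
  have hX' : AnalyticAt ℂ (fun w => X (χ w, U w)) z₀ :=
    AnalyticAt.comp (f := fun w => (χ w, U w)) hX hpair
  have hY' : AnalyticAt ℂ (fun w => Y (χ w, U w)) z₀ :=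
    AnalyticAt.comp (f := fun w => (χ w, U w)) hY hpair
  have hJ' : jac (fun w => X (χ w, U w)) (fun w => Y (χ w, U w)) z₀ ≠ 0 := by
    rw [jac_comp hX.differentiableAt hY.differentiableAt hχ.differentiableAt hU.differentiableAt]
    exact mul_ne_zero hJXY hJ
  obtain ⟨A', B', C', D', hA', hB', hC', hD', hl₁, hl₂, hstr'⟩ :=
    exists_straightened_equation hX' hY' hJ'
  obtain ⟨W, hW, hmaps⟩ := h.maps_solutions
  have hc : Tendsto toComplex (𝓝 p) (𝓝 z₀) := continuous_toComplex.tendsto p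
  have hc' : Tendsto (fun w => (χ w, U w)) (𝓝 z₀) (𝓝 (χ z₀, U z₀)) := hpair.continuousAt
  have hcoef : ∀ᶠ q in 𝓝 p, S.SplitsAt A B C D q ∧ A (toComplex q) = A' (toComplex q) ∧
      B (toComplex q) = B' (toComplex q) ∧ C (toComplex q) = C' (toComplex q) ∧
      D (toComplex q) = D' (toComplex q) := by
    filter_upwards [hS.eventually, eventually_mem_nhds_iff.2 hW,
      hc.eventually hχ.eventually_analyticAt, hc.eventually hU.eventually_analyticAt,
      hc.eventually (hc'.eventually hX.eventually_analyticAt),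
      hc.eventually (hc'.eventually hY.eventually_analyticAt),
      hc.eventually (hc'.eventually hstr), hc.eventually hstr',
      hc.eventually ((hX'.jac hY').continuousAt.eventually_ne hJ'),
      hc.eventually ((hχ.jac hU).continuousAt.eventually_ne hJ)]
      with q h1 h2 h3 h4 h5 h6 h7 h8 h9 h10
    refine ⟨h1, ?_⟩
    -- The nonzero Jacobian leaves at most one slope m along which χ fails to be a parameter.
    have hαβ : pdx χ (toComplex q) ≠ 0 ∨ pdu χ (toComplex q) ≠ 0 := by
      by_contra hcon
      push Not at hcon
      apply h10
      rw [jac, hcon.1, hcon.2]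
      ring
    obtain ⟨e1, e2, e3, e4⟩ := cubic_coeffs_eq_zero hαβ
      (a := A (toComplex q) - A' (toComplex q)) (b := B (toComplex q) - B' (toComplex q))
      (c := C (toComplex q) - C' (toComplex q)) (d := D (toComplex q) - D' (toComplex q))
      (fun m hm => by
        have := cubic_eq_of_maps_solutions (x₀ := q.1) (f₀ := q.2.1) (g₀ := q.2.2) rfl h2 h1
          (fun a b f g hf hg hw hd => (hmaps a b f g hf hg hw hd).1) h3 h4 h5 h6 h7 h8 h9 hm
        linear_combination this)
    exact ⟨sub_eq_zero.1 e1, sub_eq_zero.1 e2, sub_eq_zero.1 e3, sub_eq_zero.1 e4⟩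
  refine ⟨A', B', C', D', ⟨⟨hA', ?_⟩, ⟨hB', ?_⟩, ⟨hC', ?_⟩, ⟨hD', ?_⟩⟩, hl₁, hl₂⟩
  · filter_upwards [hcoef] with q ⟨hq, e1, _⟩
    rw [← e1, hq.A.eventually_eq.self_of_nhds]
  · filter_upwards [hcoef] with q ⟨hq, _, e2, _⟩
    rw [← e2, hq.B.eventually_eq.self_of_nhds]
  · filter_upwards [hcoef] with q ⟨hq, _, _, e3, _⟩
    rw [← e3, hq.C.eventually_eq.self_of_nhds]
  · filter_upwards [hcoef] with q ⟨hq, _, _, _, e4⟩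
    rw [← e4, hq.D.eventually_eq.self_of_nhds]

end Necessity

end CplxLin

end

theorem theorem3 (Ω : Set (ℝ × ℝ × ℝ)) (hΩ : IsOpen Ω) (S : CplxLin.Coeffs)
    (hA : CplxLin.IsAnalyticSplitting Ω S.A₁ S.A₂)
    (hB : CplxLin.IsAnalyticSplitting Ω S.B₁ S.B₂)
    (hC : CplxLin.IsAnalyticSplitting Ω S.C₁ S.C₂)
    (hD : CplxLin.IsAnalyticSplitting Ω S.D₁ S.D₂) :
    CplxLin.SolvableByComplexLinearization S.rhs₁ S.rhs₂ Ω ↔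
      ∀ x f g : ℝ, (x, f, g) ∈ Ω →
        S.cond₁ x f g = 0 ∧ S.cond₂ x f g = 0 ∧ S.cond₃ x f g = 0 ∧ S.cond₄ x f g = 0 := by
  have hsplit : ∀ p ∈ Ω, ∃ A B C D : ℂ × ℂ → ℂ, S.SplitsAt A B C D p := by
    intro p hp
    obtain ⟨A, hA₁, hA₂⟩ := hA p hp
    obtain ⟨B, hB₁, hB₂⟩ := hB p hp
    obtain ⟨C, hC₁, hC₂⟩ := hC p hp
    obtain ⟨D, hD₁, hD₂⟩ := hD p hp
    exact ⟨A, B, C, D, ⟨hA₁, hA₂⟩, ⟨hB₁, hB₂⟩, ⟨hC₁, hC₂⟩, ⟨hD₁, hD₂⟩⟩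
  constructor
  · intro h x f g hp
    obtain ⟨A, B, C, D, hS⟩ := hsplit _ hp
    obtain ⟨χ, U, P, Q, R, hlin⟩ := h _ hp
    obtain ⟨A', B', C', D', hS', hl₁, hl₂⟩ := hlin.exists_splitsAt hS
    exact (CplxLin.cond_iff_lie hS'.A hS'.B hS'.C hS'.D).2 ⟨hl₁, hl₂⟩
  · intro h p hp
    obtain ⟨A, B, C, D, hS⟩ := hsplit p hp
    have hlie : ∀ᶠ q in 𝓝 p, CplxLin.lie₁ A B C D (CplxLin.toComplex q) = 0 ∧
        CplxLin.lie₂ A B C D (CplxLin.toComplex q) = 0 := by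
      filter_upwards [hS.eventually, hΩ.mem_nhds hp] with q hq hqΩ
      exact (CplxLin.cond_iff_lie hq.A hq.B hq.C hq.D).1 (h _ _ _ hqΩ)
    -- The conditions speak only of real x, whereas integrability of the frame system needs the
    -- invariants to vanish on an open set of ℂ².
    have hl₁ := CplxLin.eventually_eq_zero_of_real
      (CplxLin.analyticAt_lie₁ hS.A.analyticAt hS.B.analyticAt hS.C.analyticAt hS.D.analyticAt)
      (hlie.mono fun _ hq => hq.1)
    have hl₂ := CplxLin.eventually_eq_zero_of_real
      (CplxLin.analyticAt_lie₂ hS.A.analyticAt hS.B.analyticAt hS.C.analyticAt hS.D.analyticAt)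
      (hlie.mono fun _ hq => hq.2)
    obtain ⟨χ, U, hlin⟩ := CplxLin.exists_linearizesAt hS hl₁ hl₂
    exact ⟨χ, U, 0, 0, 0, hlin⟩
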